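/- All graphs are finite and simple. A $C_5$-coloring of a graph $G$ is a map $c: V(G)\to V(C_5)$ such that $c(u)c(v)\in E(C_5)$ for every edge $uv\in E(G)$. A minimal obstruction to $C_5$-coloring is a graph that has no $C_5$-coloring but each of whose proper induced subgraphs has one. For integers $a,b,c\ge 1$, $S_{a,b,c}$ denotes the graph obtained from paths on $a+1$, $b+1$ and $c+1$ vertices by identifying one endpoint of each. A graph is $F$-free if none of its induced subgraphs is isomorphic to $F$, and $\{F_1,\dots,F_k\}$-free if it is $F_i$-free for each $i$. Theorem 2. Up to isomorphism, there are exactly $3$ minimal obstructions to $C_5$-coloring among $S_{2,2,1}$-free graphs, and exactly $5$ minimal obstructions to $C_5$-coloring among $S_{3,1,1}$-free graphs. Explicitly, let $W$ be the graph on $\mathbb{Z}/8$ with the edges $\{i,i+1\}$ for all $i$ and the four chords $\{0,4\},\{1,5\},\{2,6\},\{3,7\}$, and let $X$ be the graph on $\mathbb{Z}/13$ in which $i$ is adjacent to $i\pm 1$ and $i\pm 4$. Let $O_1$, $O_2$, $O_3$ be the graphs obtained from the cycle on $\mathbb{Z}/8$ with the edges $\{i,i+1\}$ by adding the chords $\{0,4\},\{3,7\}$;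 the chords $\{0,4\},\{1,5\},\{3,7\}$; and the chords $\{1,5\},\{3,7\}$, respectively. Then the $S_{2,2,1}$-free minimal obstructions are $K_3$, $W$ and $X$, and the $S_{3,1,1}$-free minimal obstructions are $K_3$, $W$, $O_1$, $O_2$ and $O_3$. Moreover, for $F\in\{S_{2,2,1},S_{3,1,1}\}$, every $\{F,C_5,K_3\}$-free graph is $C_5$-colorable. -/

import Mathlib

universe u

open SimpleGraph

namespace HColoring

/-- `G` is a minimal obstruction to `H`-coloring: `G` has no homomorphism to `H`, but every proper
induced subgraph of `G` has one. -/
def IsMinimalObstruction {V W : Type*} (H : SimpleGraph W) (G : SimpleGraph V) : Prop :=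
  ¬ Nonempty (G →g H) ∧ ∀ s : Set V, s ≠ Set.univ → Nonempty (G.induce s →g H)

/-- `G` is `F`-free: no induced subgraph of `G` is isomorphic to `F`. -/
def InducedFree {V W : Type*} (F : SimpleGraph W) (G : SimpleGraph V) : Prop :=
  ¬ F.IsIndContained G

/-- The complete graph on three vertices. -/
abbrev K3 : SimpleGraph (Fin 3) := completeGraph (Fin 3)

/-- The cycle on five vertices. -/
abbrev C5 : SimpleGraph (Fin 5) := cycleGraph 5

/-- The subdivided claw `S_{a,b,c}`: a centre `none` and three legs of `a`, `b`, `c` further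
vertices. The vertex `some ⟨i, j⟩` is the one at distance `j + 1` from the centre on leg `i`. -/
def subdividedClaw (a b c : ℕ) : SimpleGraph (Option (Σ i : Fin 3, Fin (![a, b, c] i))) :=
  SimpleGraph.fromRel fun x y =>
    match x, y with
    | none, some q => q.2.val = 0
    | some p, some q => p.1 = q.1 ∧ q.2.val = p.2.val + 1
    | _, none => False

/-- Two graphs on initial segments of `ℕ` are identified when they are isomorphic. -/
instance graphIsoSetoid : Setoid (Σ n : ℕ, SimpleGraph (Fin n)) where
  r A B := Nonempty (A.2 ≃g B.2)
  iseqv :=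
    { refl := fun _ => ⟨Iso.refl⟩
      symm := fun ⟨f⟩ => ⟨f.symm⟩
      trans := fun ⟨f⟩ ⟨g⟩ => ⟨g.comp f⟩ }

/-- The isomorphism classes of finite graphs. -/
def FiniteGraphClass : Type := Quotient graphIsoSetoid

/-- The set of isomorphism classes of finite `F`-free minimal obstructions to `H`-coloring. -/
def obstructionClasses {U W : Type*} (H : SimpleGraph W) (F : SimpleGraph U) :
    Set FiniteGraphClass :=
  {q | ∃ (n : ℕ) (G : SimpleGraph (Fin n)), q = Quotient.mk graphIsoSetoid ⟨n, G⟩ ∧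
    IsMinimalObstruction H G ∧ InducedFree F G}

/-- The eight-cycle on `0, …, 7` with all four long chords (the Wagner graph). -/
def octagon4 : SimpleGraph (Fin 8) :=
  cycleGraph 8 ⊔ SimpleGraph.fromEdgeSet {s(0, 4), s(1, 5), s(2, 6), s(3, 7)}

/-- The eight-cycle with three long chords. -/
def octagon3 : SimpleGraph (Fin 8) :=
  cycleGraph 8 ⊔ SimpleGraph.fromEdgeSet {s(0, 4), s(1, 5), s(3, 7)}

/-- The eight-cycle with two long chords whose ends are consecutive on the cycle. -/
def octagon2Adjacent : SimpleGraph (Fin 8) :=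
  cycleGraph 8 ⊔ SimpleGraph.fromEdgeSet {s(0, 4), s(3, 7)}

/-- The eight-cycle with two perpendicular long chords. -/
def octagon2Perpendicular : SimpleGraph (Fin 8) :=
  cycleGraph 8 ⊔ SimpleGraph.fromEdgeSet {s(1, 5), s(3, 7)}

/-- The circulant graph on `ℤ/13` in which `i` is adjacent to `i ± 1` and `i ± 4`. -/
def circulant13 : SimpleGraph (ZMod 13) :=
  circulantGraph {1, 4}

end HColoring

/-! A minimal obstruction `G` other than $K_3$ is triangle-free, since a contained obstruction must
be all of `G`. Two arguments then meet in a contradiction: structure forces an induced $C_5$ in `G`,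
and a finite search shows that an induced $C_5$ leads to a listed obstruction.

Structure. `G` is not bipartite, so it has a shortest odd cycle, of length $n\ge 5$. Suppose $n\ge
7$. A vertex with exactly one neighbour on the cycle would form, with five consecutive cycle
vertices, an induced $S_{2,2,1}$ or $S_{3,1,1}$, depending on where it is attached. So each vertex
attached to the cycle is a twin of a cycle vertex: its neighbours there are the two at distance one
from some position. Putting a twin in place of its position gives another shortest odd cycle, so
being a twin spreads along edges. As `G` is connected, it maps to $C_n$ and hence to $C_5$, which is
absurd. Thus $n=5$ (`IsShortestOddCycle.lt_seven`, `IsMinimalObstruction.isIndContained_C5`). The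
colorability of $\{F,C_5,K_3\}$-free graphs follows from this part alone.

Search. Let `S` be a known induced subgraph. A homomorphism from `G` to itself that misses a vertex
cannot exist (`IsMinimalObstruction.exists_not_adj`). So if moving one or two vertices of `S` is a
homomorphism of `S` that misses a vertex, some vertex outside `S` must spoil it. Its possible
neighbourhoods in `S` are restricted by forbidding the triangle and the claw; each is tried, and `S`
grows. If no such map is found, connectivity supplies the next vertex. A branch ends when `S` is
found to contain a listed obstruction or no neighbourhood remains (`check_eq_true_imp_false`). The
runs themselves are evaluated by the kernel.

Conversely, the listed graphs are finite, so their minimality, claw-freeness and pairwise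
non-isomorphism are computed directly. -/

namespace HColoring

/-! ### Induced subgraphs as triangular adjacency matrices -/

section Patterns

variable {V W : Type*}

/-- The vertex `x` is adjacent to exactly those of the listed vertices that are marked `true`, and different from the others. -/
def RowFits (G : SimpleGraph V) (x : V) : List Bool → List V → Prop
  | b :: r, y :: ys => (if b then G.Adj x y else ¬ G.Adj x y ∧ x ≠ y) ∧ RowFits G x r ys
  | _, _ => True

/-- The distinct vertices `us` induce the graph with the lower triangular adjacency matrix `P`; the vertex added last comes first. -/
def Realizes (G : SimpleGraph V) : List (List Bool) → List V → Prop
  | [], [] => True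
  | r :: P, x :: us => RowFits G x r us ∧ Realizes G P us
  | _, _ => False

/-- The rows of `P` have the lengths of a lower triangular matrix. -/
def Triangular : List (List Bool) → Prop
  | [] => True
  | r :: P => r.length = P.length ∧ Triangular P

instance decidableTriangular : (P : List (List Bool)) → Decidable (Triangular P)
  | [] => inferInstanceAs (Decidable True)
  | _ :: P => have := decidableTriangular P; inferInstanceAs (Decidable (_ ∧ _))

instance decidableRowFits (G : SimpleGraph V) [DecidableRel G.Adj] [DecidableEq V] (x : V) :
    (r : List Bool) → (us : List V) → Decidable (RowFits G x r us)
  | b :: r, y :: us =>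
    have := decidableRowFits G x r us
    inferInstanceAs (Decidable ((if b then G.Adj x y else ¬ G.Adj x y ∧ x ≠ y) ∧ _))
  | [], _ => isTrue (by unfold RowFits; trivial)
  | _ :: _, [] => isTrue (by unfold RowFits; trivial)

instance decidableRealizes (G : SimpleGraph V) [DecidableRel G.Adj] [DecidableEq V] :
    (P : List (List Bool)) → (us : List V) → Decidable (Realizes G P us)
  | [], [] => isTrue trivial
  | r :: P, x :: us =>
    have := decidableRealizes G P us
    inferInstanceAs (Decidable (RowFits G x r us ∧ _))
  | [], _ :: _ => isFalse id
  | _ :: _, [] => isFalse id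

theorem Realizes.length_eq {G : SimpleGraph V} :
    ∀ {P : List (List Bool)} {us : List V}, Realizes G P us → P.length = us.length
  | [], [], _ => rfl
  | _ :: _, _ :: _, h => congrArg (· + 1) h.2.length_eq

theorem RowFits.map {F : SimpleGraph W} {G : SimpleGraph V} (e : F ↪g G) {x : W} :
    ∀ {r : List Bool} {ws : List W}, RowFits F x r ws → RowFits G (e x) r (ws.map e)
  | [], _, _ => by unfold RowFits; trivial
  | _ :: _, [], _ => trivial
  | b :: r, w :: ws, h => by
    refine ⟨?_, h.2.map e⟩
    have := h.1
    cases b <;> simpa [e.map_adj_iff] using this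

theorem Realizes.map {F : SimpleGraph W} {G : SimpleGraph V} (e : F ↪g G) :
    ∀ {P : List (List Bool)} {ws : List W}, Realizes F P ws → Realizes G P (ws.map e)
  | [], [], _ => trivial
  | _ :: _, _ :: _, h => ⟨h.1.map e, h.2.map e⟩

theorem RowFits.zip {F : SimpleGraph W} {G : SimpleGraph V} {w : W} {u : V} :
    ∀ {r : List Bool} {ws : List W} {us : List V}, RowFits F w r ws → RowFits G u r us →
      r.length = ws.length → ∀ p ∈ ws.zip us, w ≠ p.1 ∧ u ≠ p.2 ∧ (F.Adj w p.1 ↔ G.Adj u p.2)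
  | _, [], _, _, _, _ => by simp
  | _, _ :: _, [], _, _, _ => by simp
  | [], _ :: _, _ :: _, _, _, h => by simp at h
  | b :: r, x :: ws, y :: us, hF, hG, hl => by
    intro p hp
    rcases List.mem_cons.1 hp with rfl | hp
    · have h1 := hF.1
      have h2 := hG.1
      cases b
      · simp only [Bool.false_eq_true, if_false] at h1 h2
        exact ⟨h1.2, h2.2, by simp [h1.1, h2.1]⟩
      · simp only [if_true] at h1 h2
        exact ⟨h1.ne, h2.ne, by simp [h1, h2]⟩
    · exact hF.2.zip hG.2 (by simpa using hl) p hp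

theorem Realizes.zip {F : SimpleGraph W} {G : SimpleGraph V} :
    ∀ {P : List (List Bool)} {ws : List W} {us : List V}, Triangular P → Realizes F P ws →
      Realizes G P us → ∀ p ∈ ws.zip us, ∀ q ∈ ws.zip us,
        (p.1 = q.1 ↔ p.2 = q.2) ∧ (F.Adj p.1 q.1 ↔ G.Adj p.2 q.2)
  | [], [], _, _, _, _ => by simp
  | r :: P, w :: ws, u :: us, hP, hF, hG => by
    have key := hF.1.zip hG.1 (hP.1.trans hF.2.length_eq)
    intro p hp q hq
    rcases List.mem_cons.1 hp with rfl | hp <;> rcases List.mem_cons.1 hq with rfl | hq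
    · simp
    · have := key q hq
      simp [this.1, this.2.1, this.2.2]
    · have := key p hp
      simp [this.1.symm, this.2.1.symm, this.2.2, F.adj_comm p.1, G.adj_comm p.2]
    · exact Realizes.zip hP.2 hF.2 hG.2 p hp q hq

/-- Two realizations of one matrix agree on equality and adjacency entry by entry, so pairing them
gives an embedding. `Triangular` is needed because `RowFits` silently stops at the end of a short
row. -/
theorem Realizes.isIndContained {F : SimpleGraph W} {G : SimpleGraph V} {P : List (List Bool)}
    {ws : List W} {us : List V} (hP : Triangular P) (hF : Realizes F P ws) (hws : ∀ w, w ∈ ws)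
    (hG : Realizes G P us) : F.IsIndContained G := by
  have hl : ws.length = us.length := hF.length_eq.symm.trans hG.length_eq
  have hex : ∀ w, ∃ u, (w, u) ∈ ws.zip us := by
    intro w
    obtain ⟨i, hi, rfl⟩ := List.getElem_of_mem (hws w)
    exact ⟨us[i]'(hl ▸ hi), List.mem_iff_getElem.2 ⟨i, by simp [hl ▸ hi, hi], by simp⟩⟩
  choose e he using hex
  have key := fun a b => Realizes.zip hP hF hG _ (he a) _ (he b)
  exact ⟨⟨⟨e, fun a b h => (key a b).1.2 h⟩, fun {a b} => (key a b).2.symm⟩⟩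

theorem InducedFree.not_realizes {F : SimpleGraph W} {G : SimpleGraph V} (h : InducedFree F G)
    {P : List (List Bool)} {ws : List W} (hP : Triangular P) (hF : Realizes F P ws)
    (hws : ∀ w, w ∈ ws) (us : List V) : ¬ Realizes G P us :=
  fun hG => h (hF.isIndContained hP hws hG)

theorem realizes_of_reverseAux {G : SimpleGraph V} :
    ∀ (rs : List (List Bool)) {P : List (List Bool)} {zs us : List V}, rs.length = zs.length →
      Realizes G (rs.reverseAux P) (zs.reverseAux us) → Realizes G P us
  | [], _, [], _, _, h => h
  | r :: rs, P, z :: zs, us, hl, h =>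
    (realizes_of_reverseAux rs (P := r :: P) (us := z :: us) (by simpa using hl) h).2

end Patterns

/-! ### Backtracking search for a pattern, on bit masks -/

section Search

/-- The bit `i` of the mask `m`, in a form that the kernel evaluates fast. -/
def hasBit (m i : ℕ) : Bool := Nat.beq (Nat.land 1 (Nat.shiftRight m i)) 1

theorem hasBit_eq (m i : ℕ) : hasBit m i = m.testBit i := by
  have h : Nat.land 1 (Nat.shiftRight m i) = 1 &&& (m >>> i) := rfl
  rw [hasBit, h, Nat.testBit, Nat.and_comm, Nat.and_one_is_mod]
  rcases Nat.mod_two_eq_zero_or_one (m >>> i) with h | h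
  · simp only [h]; rfl
  · simp only [h]; rfl

/-- `k n`, with `n` evaluated first. -/
def seqNat {α : Type} (n : ℕ) (k : ℕ → α) : α :=
  Nat.rec (motive := fun _ => α) (k 0) (fun m _ => k (Nat.succ m)) n

/-- `k n` for positive `n`, with `n` evaluated first. -/
def nonzero (n : ℕ) (k : ℕ → Bool) : Bool :=
  Nat.rec (motive := fun _ => Bool) false (fun m _ => k (Nat.succ m)) n

/-- `k l`, with `l` evaluated first. -/
def seqList {α : Type} : List ℕ → (List ℕ → α) → α
  | [], k => k []
  | x :: xs, k => seqNat x fun x => seqList xs fun xs => k (x :: xs)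

/-- `k S`, with `S` evaluated first. -/
def seqRows {α : Type} : List (ℕ × ℕ) → (List (ℕ × ℕ) → α) → α
  | [], k => k []
  | (a, b) :: S, k => seqNat a fun a => seqNat b fun b => seqRows S fun S => k ((a, b) :: S)

@[simp] theorem seqNat_eq {α : Type} (n : ℕ) (k : ℕ → α) : seqNat n k = k n := by
  cases n <;> rfl

theorem nonzero_eq (n : ℕ) (k : ℕ → Bool) : nonzero n k = (decide (n ≠ 0) && k n) := by
  cases n <;> simp [nonzero]

@[simp] theorem seqList_eq {α : Type} (l : List ℕ) (k : List ℕ → α) : seqList l k = k l := by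
  induction l generalizing k with
  | nil => rfl
  | cons x l ih => simp [seqList, ih]

@[simp] theorem seqRows_eq {α : Type} (S : List (ℕ × ℕ)) (k : List (ℕ × ℕ) → α) :
    seqRows S k = k S := by
  induction S generalizing k with
  | nil => rfl
  | cons x S ih => simp [seqRows, ih]

/-- `List.any`, in a form that the kernel evaluates fast. -/
def anyOf {α : Type} (f : α → Bool) (S : List α) : Bool :=
  List.rec (motive := fun _ => Bool) false (fun x _ ih => Bool.rec ih true (f x)) S

theorem anyOf_eq_true {α : Type} {f : α → Bool} {S : List α} :
    anyOf f S = true ↔ ∃ x ∈ S, f x = true := by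
  induction S with
  | nil => simp [anyOf]
  | cons x S ih =>
    have : anyOf f (x :: S) = Bool.rec (anyOf f S) true (f x) := rfl
    rw [this]
    cases h : f x <;> simp [h, ih]

/-- The vertices in the mask `c` that have the adjacency pattern `r` to the listed vertices, each of which is given by its index and
the mask of its neighbours. -/
def candidates (r : List Bool) : List (ℕ × ℕ) → ℕ → ℕ :=
  List.rec (motive := fun _ => List (ℕ × ℕ) → ℕ → ℕ) (fun _ c => c)
    (fun b _ ih acc c => List.rec (motive := fun _ => ℕ) c
      (fun y ys _ => ih ys
        (Bool.rec (Nat.xor c (Nat.land c (Nat.lor y.2 (Nat.pow 2 y.1)))) (Nat.land c y.2) b)) acc) r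

/-- Backtracking search for vertices of `S` that extend `acc` by the rows `p` of an adjacency matrix. The mask `full` contains the
indices of all vertices. -/
def search (full : ℕ) (S : List (ℕ × ℕ)) (p : List (List Bool)) : List (ℕ × ℕ) → Bool :=
  List.rec (motive := fun _ => List (ℕ × ℕ) → Bool) (fun _ => true)
    (fun r _ ih acc => nonzero (candidates r acc full) fun c =>
      anyOf (fun x => Bool.rec false (ih (x :: acc)) (hasBit c x.1)) S) p

theorem search_cons {full : ℕ} {S : List (ℕ × ℕ)} {r : List Bool} {p : List (List Bool)}
    {acc : List (ℕ × ℕ)} : search full S (r :: p) acc = true ↔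
      ∃ x ∈ S, (candidates r acc full).testBit x.1 = true ∧ search full S p (x :: acc) = true := by
  have h : search full S (r :: p) acc = nonzero (candidates r acc full) fun c =>
      anyOf (fun x => Bool.rec false (search full S p (x :: acc)) (hasBit c x.1)) S := rfl
  rw [h, nonzero_eq, Bool.and_eq_true, anyOf_eq_true]
  constructor
  · rintro ⟨-, x, hx, hs⟩
    rw [hasBit_eq] at hs
    refine ⟨x, hx, ?_⟩
    cases hb : (candidates r acc full).testBit x.1 <;> simp_all
  · rintro ⟨x, hx, hb, hs⟩
    refine ⟨?_, x, hx, by simp [hasBit_eq, hb, hs]⟩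
    simp only [decide_eq_true_eq]
    rintro h0
    simp [h0] at hb

/-- The masks of `y` describe its adjacency to the vertices of `S` under the map `f`. -/
structure Describes {V : Type*} (G : SimpleGraph V) (f : ℕ → V) (S T : List (ℕ × ℕ)) : Prop where
  adj : ∀ x ∈ S, ∀ y ∈ T, (G.Adj (f x.1) (f y.1) ↔ y.2.testBit x.1 = true)
  inj : ∀ x ∈ S, ∀ y ∈ T, f x.1 = f y.1 → x.1 = y.1

theorem candidates_cons (b : Bool) (r : List Bool) (y : ℕ × ℕ) (ys : List (ℕ × ℕ)) (c : ℕ) :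
    candidates (b :: r) (y :: ys) c = candidates r ys
      (bif b then c &&& y.2 else c ^^^ (c &&& (y.2 ||| 2 ^ y.1))) := by
  cases b <;> rfl

/-- Only the masks of the vertices already placed (in `T`) are read, never that of the candidate `x`
in `S`. Hence `T` may contain a vertex that the masks of `S` do not know about. -/
theorem testBit_candidates {V : Type*} {G : SimpleGraph V} {f : ℕ → V} {S T : List (ℕ × ℕ)}
    (h : Describes G f S T) {x : ℕ × ℕ} (hx : x ∈ S) :
    ∀ (r : List Bool) (acc : List (ℕ × ℕ)) (c : ℕ), acc ⊆ T →
      ((candidates r acc c).testBit x.1 = true ↔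
        c.testBit x.1 = true ∧ RowFits G (f x.1) r (acc.map fun y => f y.1))
  | [], acc, c, _ => by simp [candidates, RowFits]
  | b :: r, [], c, _ => by simp [candidates, RowFits]
  | b :: r, y :: acc, c, hT => by
    obtain ⟨hy, hT⟩ := List.cons_subset.1 hT
    rw [candidates_cons, testBit_candidates h hx r acc _ hT, List.map_cons, RowFits,
      ← and_assoc, h.adj x hx y hy]
    refine and_congr_left fun _ => ?_
    have hne : f x.1 ≠ f y.1 ↔ x.1 ≠ y.1 :=
      not_congr ⟨h.inj x hx y hy, fun h => congrArg f h⟩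
    cases b
    · rw [hne]
      simp only [cond_false, Nat.testBit_xor, Nat.testBit_and, Nat.testBit_or, Nat.testBit_two_pow]
      by_cases hxy : x.1 = y.1
      · cases c.testBit x.1 <;> simp [hxy]
      · cases c.testBit x.1 <;> cases y.2.testBit x.1 <;> simp [hxy, Ne.symm hxy]
    · simp

theorem realizes_of_search {V : Type*} {G : SimpleGraph V} {f : ℕ → V} {S T : List (ℕ × ℕ)}
    (h : Describes G f S T) (hST : S ⊆ T) (full : ℕ) :
    ∀ (rs : List (List Bool)) (P : List (List Bool)) (acc : List (ℕ × ℕ)), acc ⊆ T →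
      Realizes G P (acc.map fun y => f y.1) → search full S rs acc = true →
      ∃ us, Realizes G (rs.reverseAux P) us
  | [], _, _, _, hP, _ => ⟨_, hP⟩
  | r :: rs, P, acc, hT, hP, hs => by
    obtain ⟨x, hx, hb, hs⟩ := search_cons.1 hs
    exact realizes_of_search h hST full rs (r :: P) (x :: acc)
      (List.cons_subset.2 ⟨hST hx, hT⟩) ⟨((testBit_candidates h hx r acc full hT).1 hb).2, hP⟩ hs

/-- Completeness of the search when `S` lists all vertices; it turns a failed search into
induced-freeness. -/
theorem search_of_realizes {V : Type*} {G : SimpleGraph V} {f : ℕ → V} {S : List (ℕ × ℕ)}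
    (h : Describes G f S S) (hf : ∀ v, ∃ x ∈ S, f x.1 = v) {full : ℕ}
    (hfull : ∀ x ∈ S, full.testBit x.1 = true) :
    ∀ (rs : List (List Bool)) (P : List (List Bool)) (acc : List (ℕ × ℕ)) (zs : List V), acc ⊆ S →
      rs.length = zs.length → Realizes G (rs.reverseAux P) (zs.reverseAux (acc.map fun y => f y.1)) →
      search full S rs acc = true
  | [], _, _, _, _, _, _ => rfl
  | r :: rs, P, acc, z :: zs, hacc, hl, hR => by
    obtain ⟨x, hx, rfl⟩ := hf z
    rw [List.length_cons, List.length_cons, Nat.add_right_cancel_iff] at hl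
    have hr := (realizes_of_reverseAux rs (P := r :: P) hl hR).1
    exact search_cons.2 ⟨x, hx, (testBit_candidates h hx r acc full hacc).2 ⟨hfull x hx, hr⟩,
      search_of_realizes h hf hfull rs (r :: P) (x :: acc) zs
        (List.cons_subset.2 ⟨hx, hacc⟩) hl hR⟩

end Search

/-! ### Backtracking search for a coloring -/

section ColorSearch

/-- The adjacency masks of the five-cycle. -/
def cycleRows : List (ℕ × ℕ) := [(0, 18), (1, 5), (2, 10), (3, 20), (4, 9)]

/-- Whether the vertex with index `i` may get a colour whose neighbours are the colours in the mask `m`. -/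
def colorOk (i m : ℕ) (acc : List (ℕ × ℕ × ℕ)) : Bool :=
  List.rec (motive := fun _ => Bool) true
    (fun p _ ih => Bool.rec ih (Bool.rec false ih (hasBit m p.1)) (hasBit p.2.2 i)) acc

/-- Backtracking search for a `C5`-coloring of the vertices of `S` that extends the partial coloring `acc`. -/
def colorSearch (S : List (ℕ × ℕ)) : List (ℕ × ℕ × ℕ) → Bool :=
  List.rec (motive := fun _ => List (ℕ × ℕ × ℕ) → Bool) (fun _ => true)
    (fun x _ ih acc => anyOf (fun c => Bool.rec false (ih ((c.1, x) :: acc)) (colorOk x.1 c.2 acc))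
      cycleRows) S

theorem colorOk_eq_true {i m : ℕ} {acc : List (ℕ × ℕ × ℕ)} : colorOk i m acc = true ↔
    ∀ p ∈ acc, p.2.2.testBit i = true → m.testBit p.1 = true := by
  induction acc with
  | nil => simp [colorOk]
  | cons p acc ih =>
    have : colorOk i m (p :: acc) =
      Bool.rec (colorOk i m acc) (Bool.rec false (colorOk i m acc) (hasBit m p.1)) (hasBit p.2.2 i) :=
        rfl
    rw [this, List.forall_mem_cons, ← ih, hasBit_eq, hasBit_eq]
    cases p.2.2.testBit i <;> cases m.testBit p.1 <;> simp

theorem colorSearch_cons {x : ℕ × ℕ} {S : List (ℕ × ℕ)} {acc : List (ℕ × ℕ × ℕ)} :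
    colorSearch (x :: S) acc = true ↔ ∃ c ∈ cycleRows,
      (∀ p ∈ acc, p.2.2.testBit x.1 = true → c.2.testBit p.1 = true) ∧
        colorSearch S ((c.1, x) :: acc) = true := by
  have h : colorSearch (x :: S) acc = anyOf (fun c =>
    Bool.rec false (colorSearch S ((c.1, x) :: acc)) (colorOk x.1 c.2 acc)) cycleRows := rfl
  rw [h, anyOf_eq_true]
  refine exists_congr fun c => and_congr_right fun _ => ?_
  rw [← colorOk_eq_true]
  cases colorOk x.1 c.2 acc <;> simp

theorem cycleRows_testBit {c : ℕ × ℕ} (hc : c ∈ cycleRows) {a : ℕ} (h : c.2.testBit a = true)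
    (ha : ∃ m, (a, m) ∈ cycleRows) : C5.Adj (Fin.ofNat 5 c.1) (Fin.ofNat 5 a) := by
  obtain ⟨m, hm⟩ := ha
  revert h
  fin_cases hc <;> fin_cases hm <;> decide

theorem exists_colors_of_colorSearch :
    ∀ (S : List (ℕ × ℕ)) (acc : List (ℕ × ℕ × ℕ)), colorSearch S acc = true →
      (∀ p ∈ acc, ∃ m, (p.1, m) ∈ cycleRows) →
      acc.Pairwise (fun p q => q.2.2.testBit p.2.1 = true → C5.Adj (Fin.ofNat 5 p.1) (Fin.ofNat 5 q.1)) →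
      ∃ cs : List (ℕ × ℕ × ℕ), (∀ x, (x ∈ S ∨ x ∈ acc.map Prod.snd) ↔ x ∈ cs.map Prod.snd) ∧
        cs.Pairwise (fun p q => q.2.2.testBit p.2.1 = true → C5.Adj (Fin.ofNat 5 p.1) (Fin.ofNat 5 q.1))
  | [], acc, _, _, hacc => ⟨acc, by simp, hacc⟩
  | x :: S, acc, h, hm, hacc => by
    obtain ⟨c, hc, hc', hS⟩ := colorSearch_cons.1 h
    obtain ⟨cs, hcs, hp⟩ := exists_colors_of_colorSearch S ((c.1, x) :: acc) hS
      (List.forall_mem_cons.2 ⟨⟨c.2, hc⟩, hm⟩)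
      (List.pairwise_cons.2 ⟨fun p hp h => cycleRows_testBit hc (hc' p hp h) (hm p hp), hacc⟩)
    refine ⟨cs, fun z => ?_, hp⟩
    rw [← hcs z]
    simp only [List.mem_cons, List.map_cons]
    tauto

theorem nonempty_hom_of_colorSearch {V : Type*} {G : SimpleGraph V} {f : ℕ → V} {S : List (ℕ × ℕ)}
    (h : Describes G f S S) (hS : colorSearch S [] = true) :
    Nonempty (G.induce {v | ∃ x ∈ S, f x.1 = v} →g C5) := by
  obtain ⟨cs, hcs, hp⟩ := exists_colors_of_colorSearch S [] hS (by simp) (by simp)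
  have hmem : ∀ p ∈ cs, p.2 ∈ S := fun p hp => by
    simpa using (hcs p.2).2 (List.mem_map_of_mem hp)
  have key : ∀ p ∈ cs, ∀ q ∈ cs, G.Adj (f p.2.1) (f q.2.1) →
      C5.Adj (Fin.ofNat 5 p.1) (Fin.ofNat 5 q.1) := by
    have hp' : cs.Pairwise (fun p q => G.Adj (f p.2.1) (f q.2.1) →
        C5.Adj (Fin.ofNat 5 p.1) (Fin.ofNat 5 q.1)) := by
      refine hp.imp_of_mem fun {p q} hp hq hpq hadj => hpq ?_
      exact (h.adj _ (hmem p hp) _ (hmem q hq)).1 hadj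
    intro p hp q hq
    by_cases hpq : p = q
    · subst hpq
      exact fun h => absurd h (G.loopless.irrefl _)
    · have : Std.Symm fun p q : ℕ × ℕ × ℕ => G.Adj (f p.2.1) (f q.2.1) →
          C5.Adj (Fin.ofNat 5 p.1) (Fin.ofNat 5 q.1) := ⟨fun a b hab hba => (hab hba.symm).symm⟩
      exact hp'.forall hp hq hpq
  have hex : ∀ v : {v | ∃ x ∈ S, f x.1 = v}, ∃ p ∈ cs, f p.2.1 = v := by
    rintro ⟨v, x, hx, rfl⟩
    obtain ⟨p, hp, rfl⟩ := List.mem_map.1 ((hcs x).1 (Or.inl hx))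
    exact ⟨p, hp, rfl⟩
  choose c hc hcf using hex
  refine ⟨⟨fun v => Fin.ofNat 5 (c v).1, fun {u v} huv => key _ (hc u) _ (hc v) ?_⟩⟩
  rw [hcf, hcf]
  exact huv

/-- Completeness: the search can follow the colors of `φ`. A failed search therefore proves
non-colorability. -/
theorem colorSearch_of_hom {V : Type*} {G : SimpleGraph V} {f : ℕ → V} {T : List (ℕ × ℕ)}
    (h : Describes G f T T) (φ : G →g C5) :
    ∀ S acc : List (ℕ × ℕ), S ⊆ T → acc ⊆ T →
      colorSearch S (acc.map fun y => ((φ (f y.1)).val, y)) = true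
  | [], _, _, _ => rfl
  | x :: S, acc, hS, hacc => by
    obtain ⟨hx, hS⟩ := List.cons_subset.1 hS
    have hrow : ∀ a : Fin 5, ∃ m, (a.val, m) ∈ cycleRows ∧ ∀ b, C5.Adj a b → m.testBit b.val = true := by
      intro a
      fin_cases a
      · exact ⟨18, by decide, by decide⟩
      · exact ⟨5, by decide, by decide⟩
      · exact ⟨10, by decide, by decide⟩
      · exact ⟨20, by decide, by decide⟩
      · exact ⟨9, by decide, by decide⟩
    obtain ⟨m, hm, hm'⟩ := hrow (φ (f x.1))
    refine colorSearch_cons.2 ⟨_, hm, ?_, colorSearch_of_hom h φ S (x :: acc) hS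
      (List.cons_subset.2 ⟨hx, hacc⟩)⟩
    simp only [List.mem_map]
    rintro _ ⟨y, hy, rfl⟩ hxy
    exact hm' _ (φ.map_adj ((h.adj x hx y (hacc hy)).2 hxy))

end ColorSearch

/-! ### General properties of minimal obstructions -/

section MinimalObstruction

variable {V W U : Type*} {G : SimpleGraph V} {H : SimpleGraph W}

theorem nonempty_hom_induce {s t : Set V} (h : s ⊆ t) (ht : Nonempty (G.induce t →g H)) :
    Nonempty (G.induce s →g H) :=
  ht.map fun φ => φ.comp (G.induceHomOfLE h).toHom

/-- A minimal obstruction does not map to a proper induced subgraph of itself; in particular the map that moves only `a` to `a'` and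
`b` to `b'` is not a homomorphism, unless it is onto. -/
theorem IsMinimalObstruction.exists_not_adj (hG : IsMinimalObstruction H G) {a a' b b' : V}
    (ha : a ≠ a') (hb : a ≠ b') (hab : G.Adj a b → G.Adj a' b') :
    ∃ w, w ≠ a ∧ w ≠ b ∧ (G.Adj a w ∧ ¬ G.Adj a' w ∨ G.Adj b w ∧ ¬ G.Adj b' w) := by
  classical
  -- Without such a `w` the map `g` below is an endomorphism that misses `a`: the edge `ab` is
  -- preserved by `hab`, and edges away from `a` and `b` are fixed. Composing with a coloring of the
  -- complement of `a` colors `G`.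
  by_contra! hcon
  obtain ⟨φ⟩ := hG.2 {a}ᶜ (by simp)
  let g : V → V := fun v => if v = a then a' else if v = b then b' else v
  have hg : ∀ v, g v ∈ ({a}ᶜ : Set V) := by
    intro v
    simp only [g, Set.mem_compl_iff, Set.mem_singleton_iff]
    split_ifs with h1 h2
    · exact ha.symm
    · exact hb.symm
    · exact h1
  have hadj : ∀ u v, G.Adj u v → G.Adj (g u) (g v) := by
    intro u v huv
    simp only [g]
    split_ifs with h1 h2 h3 h4 h5 h6 h7
    · exact absurd huv (by rw [h1, h2]; exact G.loopless.irrefl _)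
    · subst h1; subst h3; exact hab huv
    · subst h1; exact (hcon v h2 h3).1 huv
    · subst h4; subst h5; exact (hab huv.symm).symm
    · exact absurd huv (by rw [h4, h6]; exact G.loopless.irrefl _)
    · subst h4; exact (hcon v h5 h6).2 huv
    · subst h7; exact ((hcon u h1 h4).1 huv.symm).symm
    · rename_i h8
      subst h8; exact ((hcon u h1 h4).2 huv.symm).symm
    · exact huv
  exact hG.1 ⟨φ.comp ⟨fun v => ⟨g v, hg v⟩, fun {u v} huv => hadj u v huv⟩⟩

/-- Connectivity: if no edge left `s`, colorings of `s` and of its complement would glue to one of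
`G`. -/
theorem IsMinimalObstruction.exists_adj (hG : IsMinimalObstruction H G) {s : Set V}
    (hs : s.Nonempty) (hs' : s ≠ Set.univ) : ∃ a ∈ s, ∃ b ∉ s, G.Adj a b := by
  classical
  by_contra! hcon
  obtain ⟨φ⟩ := hG.2 s hs'
  obtain ⟨ψ⟩ := hG.2 sᶜ (by simpa [Set.nonempty_iff_ne_empty] using hs)
  refine hG.1 ⟨⟨fun v => if h : v ∈ s then φ ⟨v, h⟩ else ψ ⟨v, h⟩, fun {u v} huv => ?_⟩⟩
  by_cases hu : u ∈ s <;> by_cases hv : v ∈ s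
  · simpa [hu, hv] using φ.map_adj (show (G.induce s).Adj ⟨u, hu⟩ ⟨v, hv⟩ from huv)
  · exact absurd huv (hcon u hu v hv)
  · exact absurd huv.symm (hcon v hv u hu)
  · simpa [hu, hv] using ψ.map_adj (show (G.induce sᶜ).Adj ⟨u, hu⟩ ⟨v, hv⟩ from huv)

/-- The image of the embedding is not colorable, so it cannot be a proper subset. -/
theorem IsMinimalObstruction.nonempty_iso (hG : IsMinimalObstruction H G) {O : SimpleGraph U}
    (hO : ¬ Nonempty (O →g H)) (h : O.IsIndContained G) : Nonempty (G ≃g O) := by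
  obtain ⟨e⟩ := h
  have hsurj : Function.Surjective e := by
    rw [← Set.range_eq_univ]
    by_contra hne
    obtain ⟨φ⟩ := hG.2 _ hne
    exact hO ⟨φ.comp ⟨fun u => ⟨e u, u, rfl⟩, fun {u v} huv => e.map_adj_iff.2 huv⟩⟩
  exact ⟨(RelIso.ofSurjective e hsurj).symm⟩

theorem IsMinimalObstruction.of_iso {O : SimpleGraph U} (hO : IsMinimalObstruction H O)
    (e : G ≃g O) : IsMinimalObstruction H G := by
  refine ⟨fun ⟨φ⟩ => hO.1 ⟨φ.comp e.symm.toHom⟩, fun s hs => ?_⟩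
  obtain ⟨φ⟩ := hO.2 (e '' s) (by
    rwa [Ne, ← Set.image_univ_of_surjective e.surjective, e.injective.image_injective.eq_iff])
  exact ⟨φ.comp ⟨fun v => ⟨e v, v, v.2, rfl⟩, fun {u v} huv => e.map_adj_iff.2 huv⟩⟩

theorem InducedFree.of_iso {F : SimpleGraph W} {O : SimpleGraph U} (hO : InducedFree F O)
    (e : G ≃g O) : InducedFree F G :=
  fun ⟨f⟩ => hO ⟨f.trans e.toEmbedding⟩

theorem InducedFree.induce {F : SimpleGraph W} (h : InducedFree F G) (s : Set V) :
    InducedFree F (G.induce s) :=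
  fun ⟨f⟩ => h ⟨f.trans (SimpleGraph.Embedding.induce s)⟩

theorem exists_isMinimalObstruction_induce [Finite V] (h : ¬ Nonempty (G →g H)) :
    ∃ s : Set V, IsMinimalObstruction H (G.induce s) := by
  obtain ⟨s, hs, hmin⟩ := (Set.toFinite {s : Set V | ¬ Nonempty (G.induce s →g H)}).exists_minimal
    ⟨Set.univ, fun ⟨φ⟩ => h ⟨φ.comp ⟨fun v => ⟨v, trivial⟩, fun {u v} huv => huv⟩⟩⟩
  refine ⟨s, hs, fun t ht => ?_⟩
  have hsub : Subtype.val '' t ⊆ s := by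
    rintro _ ⟨v, -, rfl⟩
    exact v.2
  have : Nonempty (G.induce (Subtype.val '' t) →g H) := by
    by_contra hcon
    have hle := hmin hcon hsub
    refine ht (Set.eq_univ_of_forall fun v => ?_)
    obtain ⟨w, hw, hwv⟩ := hle v.2
    rwa [← Subtype.ext hwv]
  exact this.map fun φ => φ.comp ⟨fun v => ⟨v.1.1, v.1, v.2, rfl⟩, fun {u v} huv => huv⟩

end MinimalObstruction

/-! ### The obstruction search and its soundness -/

section Check

/-- Two vertices and their targets: `(a, a', b, b')` stands for the map that moves `a` to `a'` and `b` to `b'`. Each vertex is given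
by its index and the mask of its neighbours. -/
abbrev Fold := (ℕ × ℕ) × (ℕ × ℕ) × (ℕ × ℕ) × (ℕ × ℕ)

/-- Whether a vertex with the neighbours `M` respects the fold `m`. -/
def closedUnder (m : Fold) (M : ℕ) : Bool :=
  (!hasBit M m.1.1 || hasBit M m.2.1.1) && (!hasBit M m.2.2.1.1 || hasBit M m.2.2.2.1)

/-- Whether the mask `r` is contained in `r'` up to the bit `i`. -/
def subMask (r r' i : ℕ) : Bool := Nat.beq (Nat.land r (Nat.lor r' (Nat.pow 2 i))) r

/-- Whether `a'` is adjacent to all neighbours of `a` except possibly `b`. -/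
def dominated (a a' b : ℕ × ℕ) : Bool :=
  Bool.rec (subMask a.2 a'.2 b.1) false (Nat.beq a.1 a'.1)

/-- Whether the fold `m` is a homomorphism that misses a vertex. -/
def validFold (m : Fold) : Bool :=
  dominated m.1 m.2.1 m.2.2.1 && subMask m.2.2.1.2 m.2.2.2.2 m.1.1 &&
    !(Nat.beq m.1.1 m.2.2.2.1) && (!hasBit m.1.2 m.2.2.1.1 || hasBit m.2.1.2 m.2.2.2.1)

/-- `List.findSome?`, in a form that the kernel evaluates fast. -/
def firstSome {α β : Type} (f : α → Option β) (S : List α) : Option β :=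
  List.rec (motive := fun _ => Option β) none (fun x _ ih => Option.rec ih some (f x)) S

/-- A valid fold of the vertices `S` that moves one vertex, or else one that moves two adjacent vertices. -/
def findFold (S : List (ℕ × ℕ)) : Option Fold :=
  Option.rec
    (firstSome (fun a => firstSome (fun b => cond (hasBit a.2 b.1)
      (firstSome (fun a' => cond (dominated a a' b)
        (firstSome (fun b' => cond (validFold (a, a', b, b')) (some (a, a', b, b')) none) S) none) S)
      none) S) S)
    some
    (firstSome (fun a => firstSome (fun a' =>
      cond (validFold (a, a', a', a')) (some (a, a', a', a')) none) S) S)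

/-- The graph `S` with a new vertex of index `n` that has the neighbours `M`. -/
def extend (S : List (ℕ × ℕ)) (n M : ℕ) : List (ℕ × ℕ) :=
  S.map (fun x => (x.1, bif hasBit M x.1 then Nat.lor x.2 (Nat.pow 2 n) else x.2)) ++ [(n, M)]

/-- The neighbourhoods from `L` that a new vertex of index `n` can have without completing one of the patterns `forb`. -/
def admissible (forb : List (List (List Bool))) (S : List (ℕ × ℕ)) (n : ℕ) (L : List ℕ) : List ℕ :=
  L.filter fun M => !forb.any fun p => search (Nat.pred (Nat.pow 2 n)) S p [(n, M)]

/-- The neighbourhoods that extend those from `L` to the further vertex `n`. -/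
def refineMasks (L : List ℕ) (n : ℕ) : List ℕ := L.flatMap fun M => [Nat.lor M (Nat.pow 2 n), M]

/-- Run `chk` on the neighbourhoods in the first list, each of which is excluded once it has been dealt with. -/
def branch (chk : List ℕ → ℕ → Bool) : List ℕ → List ℕ → Bool
  | [], _ => true
  | M :: Ms, L =>
    seqList L fun L => chk L M && branch chk Ms (L.filter fun M' => !Nat.beq M M')

/-- A search whose success shows that each minimal obstruction that contains the induced subgraph `S` on `n` vertices, in which the
neighbourhoods in `S` of all further vertices belong to `L`, contains a pattern from `forb` or from `obs`. If `S` is colorable, then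
there is a vertex that does not respect a given fold of `S`, and each possible neighbourhood of it in `S` is tried. -/
def check (forb obs : List (List (List Bool))) : ℕ → List (ℕ × ℕ) → ℕ → List ℕ → Bool
  | 0, _, _, _ => false
  | k + 1, S, n, L => cond (colorSearch S [])
      (seqList (admissible forb S n L) fun L =>
      let chk := fun L' M =>
        seqRows (extend S n M) fun S' => seqList (refineMasks L' n) fun L' =>
        seqNat (n + 1) fun n' => check forb obs k S' n' L'
      match findFold S with
      | none => seqList (L.filter fun M => !Nat.beq M 0) fun Ms => branch chk Ms L
      | some m => seqList (L.filter fun M => !closedUnder m M) fun Ms => branch chk Ms L)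
      (obs.any fun p => search (Nat.pred (Nat.pow 2 n)) S p [])

theorem firstSome_eq_some {α β : Type} {f : α → Option β} {S : List α} {y : β}
    (h : firstSome f S = some y) : ∃ x ∈ S, f x = some y := by
  induction S with
  | nil => exact absurd h (by simp [firstSome])
  | cons x S ih =>
    have hc : firstSome f (x :: S) = Option.rec (firstSome f S) some (f x) := rfl
    rw [hc] at h
    cases hx : f x with
    | none =>
      rw [hx] at h
      obtain ⟨z, hz, hz'⟩ := ih h
      exact ⟨z, List.mem_cons_of_mem _ hz, hz'⟩
    | some z =>
      rw [hx] at h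
      exact ⟨x, List.mem_cons_self, hx.trans h⟩

theorem some_of_cond {α : Type} {c : Bool} {o : Option α} {y : α} (h : cond c o none = some y) :
    c = true ∧ o = some y := by
  cases c <;> simp_all

theorem findFold_eq_some {S : List (ℕ × ℕ)} {m : Fold} (h : findFold S = some m) :
    m.1 ∈ S ∧ m.2.1 ∈ S ∧ m.2.2.1 ∈ S ∧ m.2.2.2 ∈ S ∧ validFold m = true := by
  unfold findFold at h
  cases h1 : firstSome (fun a => firstSome (fun a' =>
      cond (validFold (a, a', a', a')) (some (a, a', a', a')) none) S) S with
  | none =>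
    rw [h1] at h
    obtain ⟨a, ha, h⟩ := firstSome_eq_some h
    obtain ⟨b, hb, h⟩ := firstSome_eq_some h
    obtain ⟨-, h⟩ := some_of_cond h
    obtain ⟨a', ha', h⟩ := firstSome_eq_some h
    obtain ⟨-, h⟩ := some_of_cond h
    obtain ⟨b', hb', h⟩ := firstSome_eq_some h
    obtain ⟨hv, h⟩ := some_of_cond h
    cases h
    exact ⟨ha, ha', hb, hb', hv⟩
  | some m' =>
    rw [h1] at h
    cases h
    obtain ⟨a, ha, h⟩ := firstSome_eq_some h1
    obtain ⟨a', ha', h⟩ := firstSome_eq_some h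
    obtain ⟨hv, h⟩ := some_of_cond h
    cases h
    exact ⟨ha, ha', ha', ha', hv⟩

theorem testBit_of_subMask {r r' i j : ℕ} (h : subMask r r' i = true) (hj : r.testBit j = true) :
    r'.testBit j = true ∨ j = i := by
  have h' : r &&& (r' ||| 2 ^ i) = r := Nat.eq_of_beq_eq_true h
  rw [← h'] at hj
  simp only [Nat.testBit_and, Nat.testBit_or, Nat.testBit_two_pow, Bool.and_eq_true,
    Bool.or_eq_true, decide_eq_true_eq] at hj
  exact hj.2.imp_right Eq.symm

variable {V : Type*} {G : SimpleGraph V} {f : ℕ → V} {S : List (ℕ × ℕ)} {n : ℕ}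

/-- The vertices `S`, with indices and neighbours below `n`, describe an induced subgraph of `G`. -/
structure State (G : SimpleGraph V) (f : ℕ → V) (S : List (ℕ × ℕ)) (n : ℕ) : Prop
    extends Describes G f S S where
  lt : ∀ x ∈ S, x.1 < n ∧ x.2 < 2 ^ n

/-- The vertex `w` is different from all vertices of `S`, and its neighbours there are the ones in `M`. -/
structure IsTrace (G : SimpleGraph V) (f : ℕ → V) (S : List (ℕ × ℕ)) (w : V) (M : ℕ) : Prop where
  ne : ∀ x ∈ S, f x.1 ≠ w
  adj : ∀ x ∈ S, (G.Adj (f x.1) w ↔ M.testBit x.1 = true)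

/-- All masks of `L` are below `2 ^ n`, and each vertex outside of `S` has its neighbourhood in `L`. -/
structure Covers (G : SimpleGraph V) (f : ℕ → V) (S : List (ℕ × ℕ)) (n : ℕ) (L : List ℕ) : Prop where
  lt : ∀ M ∈ L, M < 2 ^ n
  trace : ∀ w, (∀ x ∈ S, f x.1 ≠ w) → ∃ M ∈ L, IsTrace G f S w M

theorem mem_extend {M : ℕ} {z : ℕ × ℕ} (hz : z ∈ extend S n M) :
    (∃ x ∈ S, z = (x.1, if M.testBit x.1 then x.2 ||| 2 ^ n else x.2)) ∨ z = (n, M) := by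
  simp only [extend, List.mem_append, List.mem_map, List.mem_singleton, hasBit_eq] at hz
  refine hz.imp_left ?_
  rintro ⟨x, hx, rfl⟩
  refine ⟨x, hx, ?_⟩
  cases M.testBit x.1 <;> rfl

/-- The bounds in `State` make `n` a fresh index: bit `n` of every old mask is clear and may record
adjacency to `w`. -/
theorem State.extend (h : State G f S n) {w : V} {M : ℕ} (hw : IsTrace G f S w M) (hM : M < 2 ^ n) :
    State G (Function.update f n w) (extend S n M) (n + 1) := by
  have hpow : 2 ^ n < 2 ^ (n + 1) := Nat.pow_lt_pow_right (by norm_num) n.lt_succ_self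
  have hf : ∀ x ∈ S, Function.update f n w x.1 = f x.1 := fun x hx =>
    Function.update_of_ne (h.lt x hx).1.ne _ _
  have hb : ∀ {m : ℕ}, m < 2 ^ n → m.testBit n = false := fun hm => Nat.testBit_lt_two_pow hm
  refine ⟨⟨fun x hx y hy => ?_, fun x hx y hy => ?_⟩, fun x hx => ?_⟩
  · rcases mem_extend hx with ⟨x, hxS, rfl⟩ | rfl <;> rcases mem_extend hy with ⟨y, hyS, rfl⟩ | rfl
    · have hne := (h.lt x hxS).1.ne'
      simp only [hf x hxS, hf y hyS, h.adj x hxS y hyS]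
      split_ifs <;> simp [Nat.testBit_or, hne]
    · simpa only [hf x hxS, Function.update_self] using hw.adj x hxS
    · simp only [hf y hyS, Function.update_self, G.adj_comm w, hw.adj y hyS]
      split_ifs with hy'
      · simp [hy', Nat.testBit_or]
      · simp [hy', hb (h.lt y hyS).2]
    · simp [hb hM]
  · rcases mem_extend hx with ⟨x, hxS, rfl⟩ | rfl <;> rcases mem_extend hy with ⟨y, hyS, rfl⟩ | rfl
    · simpa only [hf x hxS, hf y hyS] using h.inj x hxS y hyS
    · simp only [hf x hxS, Function.update_self]
      exact fun h => absurd h (hw.ne x hxS)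
    · simp only [hf y hyS, Function.update_self]
      exact fun h => absurd h.symm (hw.ne y hyS)
    · exact fun _ => rfl
  · rcases mem_extend hx with ⟨x, hxS, rfl⟩ | rfl
    · refine ⟨(h.lt x hxS).1.trans n.lt_succ_self, ?_⟩
      have := (h.lt x hxS).2.trans hpow
      dsimp only
      split_ifs
      · exact Nat.or_lt_two_pow this hpow
      · exact this
    · exact ⟨n.lt_succ_self, hM.trans hpow⟩

theorem Covers.refineMasks (h : State G f S n) {L : List ℕ} (hL : Covers G f S n L) (w : V) (M : ℕ) :
    Covers G (Function.update f n w) (HColoring.extend S n M) (n + 1) (refineMasks L n) := by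
  have hpow : 2 ^ n < 2 ^ (n + 1) := Nat.pow_lt_pow_right (by norm_num) n.lt_succ_self
  have hf : ∀ x ∈ S, Function.update f n w x.1 = f x.1 := fun x hx =>
    Function.update_of_ne (h.lt x hx).1.ne _ _
  have hlor : ∀ M', Nat.lor M' (Nat.pow 2 n) = M' ||| 2 ^ n := fun _ => rfl
  constructor
  · intro M' hM'
    simp only [HColoring.refineMasks, List.mem_flatMap, List.mem_cons, List.not_mem_nil, or_false,
      hlor] at hM'
    obtain ⟨M', hM', rfl | rfl⟩ := hM'
    · exact Nat.or_lt_two_pow ((hL.lt M' hM').trans hpow) hpow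
    · exact (hL.lt _ hM').trans hpow
  · intro v hv
    have hv' : ∀ x ∈ S, f x.1 ≠ v := by
      intro x hx
      rw [← hf x hx]
      exact hv (x.1, bif hasBit M x.1 then Nat.lor x.2 (Nat.pow 2 n) else x.2)
        (List.mem_append_left _ (List.mem_map.2 ⟨x, hx, rfl⟩))
    have hvw : w ≠ v := by
      simpa using hv (n, M) (List.mem_append_right _ (List.mem_singleton.2 rfl))
    obtain ⟨M', hM', ht⟩ := hL.trace v hv'
    refine ⟨open scoped Classical in if G.Adj w v then M' ||| 2 ^ n else M', ?_, hv, fun x hx => ?_⟩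
    · simp only [HColoring.refineMasks, List.mem_flatMap, List.mem_cons, List.not_mem_nil, or_false,
        hlor]
      refine ⟨M', hM', ?_⟩
      split_ifs <;> simp
    · rcases mem_extend hx with ⟨x, hxS, rfl⟩ | rfl
      · have hne := (h.lt x hxS).1.ne'
        simp only [hf x hxS, ht.adj x hxS]
        split_ifs <;> simp [Nat.testBit_or, hne]
      · simp only [Function.update_self]
        split_ifs with hadj
        · simp [hadj, Nat.testBit_or]
        · simp [hadj, Nat.testBit_lt_two_pow (hL.lt M' hM')]

/-- A discarded mask cannot be the trace of a vertex, as that vertex would complete a forbidden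
pattern in `G`. The new vertex is always placed first, with an empty row; this is the `[[]]`, and
the reason why each pattern is listed once for every possible first vertex. -/
theorem Covers.admissible (h : State G f S n) {L : List ℕ} (hL : Covers G f S n L)
    {forb : List (List (List Bool))}
    (hforb : ∀ p ∈ forb, ∀ us, ¬ Realizes G (p.reverseAux [[]]) us) :
    Covers G f S n (admissible forb S n L) := by
  refine ⟨fun M hM => hL.lt M (List.mem_of_mem_filter hM), fun w hw => ?_⟩
  obtain ⟨M, hM, ht⟩ := hL.trace w hw
  refine ⟨M, List.mem_filter.2 ⟨hM, ?_⟩, ht⟩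
  rw [Bool.not_eq_true', Bool.eq_false_iff]
  intro hany
  obtain ⟨p, hp, hs⟩ := List.any_eq_true.1 hany
  have hf : ∀ x ∈ S, Function.update f n w x.1 = f x.1 := fun x hx =>
    Function.update_of_ne (h.lt x hx).1.ne _ _
  have hd : Describes G (Function.update f n w) S ((n, M) :: S) := by
    refine ⟨fun x hx y hy => ?_, fun x hx y hy => ?_⟩
    · rcases List.mem_cons.1 hy with rfl | hy
      · simpa only [hf x hx, Function.update_self] using ht.adj x hx
      · simpa only [hf x hx, hf y hy] using h.adj x hx y hy
    · rcases List.mem_cons.1 hy with rfl | hy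
      · simp only [hf x hx, Function.update_self]
        exact fun h => absurd h (ht.ne x hx)
      · simpa only [hf x hx, hf y hy] using h.inj x hx y hy
  obtain ⟨us, hus⟩ := realizes_of_search hd (List.subset_cons_self _ _) _ p [[]] [(n, M)]
    (by simp) ⟨by unfold RowFits; trivial, trivial⟩ hs
  exact hforb p hp us hus

/-- Minimality yields a vertex where the fold fails in `G`. It lies outside `S`, because a valid
fold respects all edges within `S`. -/
theorem State.exists_not_closedUnder {W : Type*} {H : SimpleGraph W} (hG : IsMinimalObstruction H G)
    (h : State G f S n) {m : Fold} (hm : findFold S = some m) :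
    ∃ w, (∀ x ∈ S, f x.1 ≠ w) ∧ ∀ M, IsTrace G f S w M → closedUnder m M = false := by
  obtain ⟨ha, ha', hb, hb', hv⟩ := findFold_eq_some hm
  obtain ⟨a, a', b, b'⟩ := m
  dsimp only at ha ha' hb hb'
  simp only [validFold, dominated, Bool.and_eq_true, Bool.not_eq_true', Bool.or_eq_true,
    hasBit_eq] at hv
  obtain ⟨⟨⟨hv1, hv2⟩, hv3⟩, hv4⟩ := hv
  have hne : a.1 ≠ a'.1 := by
    intro heq
    rw [heq, Nat.beq_refl] at hv1
    exact absurd hv1 (by simp)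
  have hv1 : subMask a.2 a'.2 b.1 = true := by
    cases hbeq : Nat.beq a.1 a'.1
    · rwa [hbeq] at hv1
    · exact absurd (Nat.eq_of_beq_eq_true hbeq) hne
  have hne' : a.1 ≠ b'.1 := by
    intro heq
    rw [heq, Nat.beq_refl] at hv3
    exact absurd hv3 (by simp)
  obtain ⟨w, hwa, hwb, hw⟩ := hG.exists_not_adj (a := f a.1) (a' := f a'.1) (b := f b.1)
    (b' := f b'.1) (fun e => hne (h.inj a ha a' ha' e)) (fun e => hne' (h.inj a ha b' hb' e)) (by
      rw [G.adj_comm, h.adj b hb a ha, G.adj_comm, h.adj b' hb' a' ha']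
      rcases hv4 with hv4 | hv4 <;> simp [hv4])
  refine ⟨w, fun x hx hxw => ?_, fun M hM => ?_⟩
  · subst hxw
    simp only [G.adj_comm _ (f x.1), h.adj x hx _ ha, h.adj x hx _ ha', h.adj x hx _ hb,
      h.adj x hx _ hb'] at hw
    rcases hw with ⟨h1, h2⟩ | ⟨h1, h2⟩
    · rcases testBit_of_subMask hv1 h1 with h3 | h3
      · exact h2 h3
      · exact hwb (congrArg f h3)
    · rcases testBit_of_subMask hv2 h1 with h3 | h3
      · exact h2 h3
      · exact hwa (congrArg f h3)
  · rw [hM.adj a ha, hM.adj a' ha', hM.adj b hb, hM.adj b' hb'] at hw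
    simp only [closedUnder, hasBit_eq]
    rcases hw with ⟨h1, h2⟩ | ⟨h1, h2⟩ <;> simp [h1, h2]

/-- Either some vertex has trace `M`, and `chk` refutes this, or none has, and `M` may be dropped
from `L` for all later branches. Inside the branch of `M` itself `M` stays in `L`, since other
vertices may share this trace. -/
theorem branch_eq_true_imp_false {chk : List ℕ → ℕ → Bool}
    (hchk : ∀ L M w, Covers G f S n L → IsTrace G f S w M → M < 2 ^ n → chk L M = true → False) :
    ∀ (Ms L : List ℕ), Covers G f S n L → (∀ M ∈ Ms, M < 2 ^ n) →
      (∃ w, ∃ M ∈ Ms, IsTrace G f S w M) → branch chk Ms L = true → False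
  | [], _, _, _, ⟨_, _, hM, _⟩, _ => by simp at hM
  | M :: Ms, L, hL, hMs, ⟨w, M', hM', hw⟩, hb => by
    simp only [branch, seqList_eq, Bool.and_eq_true] at hb
    by_cases hex : ∃ w, IsTrace G f S w M
    · obtain ⟨w, hw⟩ := hex
      exact hchk L M w hL hw (hMs M List.mem_cons_self) hb.1
    · push Not at hex
      refine branch_eq_true_imp_false hchk Ms _ ⟨fun M' hM' => hL.lt M' (List.mem_of_mem_filter hM'),
        fun v hv => ?_⟩ (fun M' hM' => hMs M' (List.mem_cons_of_mem _ hM')) ⟨w, M', ?_, hw⟩ hb.2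
      · obtain ⟨M', hM', ht⟩ := hL.trace v hv
        refine ⟨M', List.mem_filter.2 ⟨hM', ?_⟩, ht⟩
        rw [Bool.not_eq_true', Bool.eq_false_iff]
        intro hbeq
        rw [Nat.eq_of_beq_eq_true hbeq] at hex
        exact hex v ht
      · rcases List.mem_cons.1 hM' with rfl | hM'
        · exact absurd hw (hex w)
        · exact hM'

/-- Induction on the fuel. A failed coloring search needs no justification here: that branch
succeeds only by exhibiting a pattern of `obs`. -/
theorem check_eq_true_imp_false (hG : IsMinimalObstruction C5 G) {forb obs : List (List (List Bool))}
    (hforb : ∀ p ∈ forb, ∀ us, ¬ Realizes G (p.reverseAux [[]]) us)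
    (hobs : ∀ p ∈ obs, ∀ us, ¬ Realizes G (p.reverseAux []) us) :
    ∀ (k : ℕ) (S : List (ℕ × ℕ)) (n : ℕ) (L : List ℕ) (f : ℕ → V), S ≠ [] → State G f S n →
      Covers G f S n L → check forb obs k S n L = true → False
  | 0, _, _, _, _, _, _, _, h => by simp [check] at h
  | k + 1, S, n, L, f, hne, hS, hL, h => by
    unfold check at h
    cases hc : colorSearch S [] with
    | false =>
      rw [hc, cond_false] at h
      obtain ⟨p, hp, hs⟩ := List.any_eq_true.1 h
      obtain ⟨us, hus⟩ := realizes_of_search hS.toDescribes (List.Subset.refl _) _ p [] []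
        (by simp) trivial hs
      exact hobs p hp us hus
    | true =>
      rw [hc, cond_true] at h
      simp only [seqRows_eq, seqList_eq, seqNat_eq] at h
      have hchk : ∀ L M w, Covers G f S n L → IsTrace G f S w M → M < 2 ^ n →
          check forb obs k (extend S n M) (n + 1) (refineMasks L n) = true → False := by
        intro L M w hL hw hM hk
        exact check_eq_true_imp_false hG hforb hobs k _ _ _ _ (by simp [extend]) (hS.extend hw hM)
          (hL.refineMasks hS w M) hk
      replace hL := hL.admissible hS hforb
      cases hm : findFold S with
      | none =>
        rw [hm] at h
        refine branch_eq_true_imp_false hchk _ _ hL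
          (fun M hM => hL.lt M (List.mem_of_mem_filter hM)) ?_ h
        -- As `S` is colorable it is not all of `G`, so by connectivity some outside vertex has a
        -- nonzero trace.
        obtain ⟨φ⟩ := nonempty_hom_of_colorSearch hS.toDescribes hc
        obtain ⟨x, hx⟩ := List.exists_mem_of_ne_nil _ hne
        obtain ⟨_, ⟨y, hy, rfl⟩, w, hw, hyw⟩ := hG.exists_adj (s := {v | ∃ x ∈ S, f x.1 = v})
          ⟨_, x, hx, rfl⟩ (fun huniv => hG.1 ⟨φ.comp ⟨fun v => ⟨v, huniv ▸ Set.mem_univ v⟩,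
            fun {u v} huv => huv⟩⟩)
        obtain ⟨M, hM, ht⟩ := hL.trace w fun x hx hxw => hw ⟨x, hx, hxw⟩
        refine ⟨w, M, List.mem_filter.2 ⟨hM, ?_⟩, ht⟩
        rw [Bool.not_eq_true', Bool.eq_false_iff]
        intro hM0
        have := (ht.adj y hy).1 hyw
        simp [Nat.eq_of_beq_eq_true hM0] at this
      | some m =>
        rw [hm] at h
        refine branch_eq_true_imp_false hchk _ _ hL
          (fun M hM => hL.lt M (List.mem_of_mem_filter hM)) ?_ h
        obtain ⟨w, hw, hw'⟩ := hS.exists_not_closedUnder hG hm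
        obtain ⟨M, hM, ht⟩ := hL.trace w hw
        exact ⟨w, M, List.mem_filter.2 ⟨hM, by simp [hw' M ht]⟩, ht⟩

end Check

/-! ### Shortest odd cycles and the existence of an induced five-cycle -/

section OddCycle

variable {V : Type*} {G : SimpleGraph V} {n : ℕ} {c : ZMod n → V}

/-- The closed walk `c` has odd length `n ≥ 5`, and there is no shorter closed walk of odd length. -/
structure IsShortestOddCycle (G : SimpleGraph V) (n : ℕ) (c : ZMod n → V) : Prop where
  odd : Odd n
  five_le : 5 ≤ n
  adj : ∀ i, G.Adj (c i) (c (i + 1))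
  le_length : ∀ (v : V) (p : G.Walk v v), Odd p.length → n ≤ p.length

theorem exists_walk_of_adj (h : ∀ i, G.Adj (c i) (c (i + 1))) (i : ZMod n) (d : ℕ) :
    ∃ p : G.Walk (c i) (c (i + d)), p.length = d := by
  induction d with
  | zero => exact ⟨Walk.nil.copy rfl (by simp), by simp⟩
  | succ d ih =>
    obtain ⟨p, hp⟩ := ih
    exact ⟨(p.concat (h _)).copy rfl (by push_cast; rw [add_assoc]), by simp [hp]⟩

namespace IsShortestOddCycle

theorem natCast_ne_zero {n a : ℕ} (ha : ¬ n ∣ a) : (a : ZMod n) ≠ 0 :=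
  fun h0 => ha ((ZMod.natCast_eq_zero_iff a n).1 h0)

theorem two_ne_zero (h : IsShortestOddCycle G n c) : (2 : ZMod n) ≠ 0 := by
  have := h.five_le
  exact_mod_cast natCast_ne_zero (n := n) (a := 2) fun hd => by linarith [Nat.le_of_dvd (by norm_num) hd]

theorem four_ne_zero (h : IsShortestOddCycle G n c) : (4 : ZMod n) ≠ 0 := by
  have := h.five_le
  exact_mod_cast natCast_ne_zero (n := n) (a := 4) fun hd => by linarith [Nat.le_of_dvd (by norm_num) hd]

theorem six_ne_zero (h : IsShortestOddCycle G n c) : (6 : ZMod n) ≠ 0 := by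
  have h5 := h.five_le
  have ho := h.odd
  refine mod_cast natCast_ne_zero (n := n) (a := 6) fun hd => ?_
  have := Nat.le_of_dvd (by norm_num) hd
  interval_cases n
  · omega
  · exact absurd ho (by decide)

theorem le_add_two (h : IsShortestOddCycle G n c) {x : V} {i : ZMod n} {d : ℕ}
    (hi : G.Adj x (c i)) (hj : G.Adj x (c (i + d))) (hd : Odd d) : n ≤ d + 2 := by
  obtain ⟨p, hp⟩ := exists_walk_of_adj h.adj i d
  have := h.le_length x (Walk.cons hi (p.concat hj.symm)) (by
    simpa [hp, Nat.odd_add, add_assoc] using hd)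
  simpa [hp] using this

/-- One of the two arcs between the neighbours is odd. Closing it through `x` gives an odd closed
walk, of length at least `n`, so the even arc has length two. -/
theorem eq_add_two_or (h : IsShortestOddCycle G n c) {x : V} {i j : ZMod n}
    (hi : G.Adj x (c i)) (hj : G.Adj x (c j)) (hij : i ≠ j) : j = i + 2 ∨ i = j + 2 := by
  have h5 := h.five_le
  have : NeZero n := ⟨by omega⟩
  obtain ⟨m, hm⟩ := h.odd
  obtain ⟨d, hd, rfl⟩ : ∃ d < n, j = i + (d : ℕ) :=
    ⟨(j - i).val, ZMod.val_lt _, by rw [ZMod.natCast_zmod_val]; ring⟩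
  have hd0 : d ≠ 0 := by
    rintro rfl
    simp at hij
  have hi' : i + (d : ZMod n) + ((n - d : ℕ) : ZMod n) = i := by
    rw [add_assoc, ← Nat.cast_add, Nat.add_sub_cancel' hd.le, ZMod.natCast_self, add_zero]
  rcases Nat.even_or_odd d with he | ho
  · have hle := h.le_add_two hj (d := n - d) (by rwa [hi']) (by
      rw [Nat.odd_sub hd.le]
      simp [h.odd, he])
    obtain ⟨k, hk⟩ := he
    have : d = 2 := by omega
    subst this
    left; norm_num
  · have hle := h.le_add_two hi hj ho
    obtain ⟨k, hk⟩ := ho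
    have : n - d = 2 := by omega
    rw [this] at hi'
    right
    exact_mod_cast hi'.symm

/-- A third neighbour would be both `i - 2` and `i + 4`, but `6 ≠ 0` modulo an odd `n ≥ 5`. -/
theorem eq_or_eq_add_two (h : IsShortestOddCycle G n c) {x : V} {i j : ZMod n}
    (hi : G.Adj x (c i)) (hi' : G.Adj x (c (i + 2))) (hj : G.Adj x (c j)) : j = i ∨ j = i + 2 := by
  by_contra! hne
  rcases h.eq_add_two_or hi hj hne.1.symm with h1 | h1
  · exact hne.2 h1
  · rcases h.eq_add_two_or hi' hj hne.2.symm with h2 | h2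
    · refine h.six_ne_zero ?_
      linear_combination -h1 - h2
    · exact hne.1 (by linear_combination -h2)

/-- The vertex `c i` already has the neighbours `c (i - 1)` and `c (i + 1)`, which leaves room for
no third. -/
theorem adj_iff (h : IsShortestOddCycle G n c) {i j : ZMod n} :
    G.Adj (c i) (c j) ↔ j = i + 1 ∨ i = j + 1 := by
  constructor
  · intro hij
    have h1 : G.Adj (c i) (c (i - 1)) := by
      simpa using (h.adj (i - 1)).symm
    have h2 : G.Adj (c i) (c (i - 1 + 2)) := by
      have := h.adj i
      rwa [show i - 1 + 2 = i + 1 by ring]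
    rcases h.eq_or_eq_add_two h1 h2 hij with rfl | rfl
    · right; ring
    · left; ring
  · rintro (rfl | rfl)
    · exact h.adj i
    · exact (h.adj j).symm

theorem injective (h : IsShortestOddCycle G n c) : Function.Injective c := by
  intro i j hij
  have h1 := h.adj j
  have h2 := h.adj (j - 1)
  rw [← hij, h.adj_iff] at h1
  rw [sub_add_cancel, ← hij, h.adj_iff] at h2
  rcases h1 with h1 | h1
  · exact (add_right_cancel h1).symm
  · rcases h2 with h2 | h2
    · linear_combination h2
    · refine absurd ?_ h.four_ne_zero
      linear_combination -h1 - h2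

theorem isIndContained_C5 {c : ZMod 5 → V} (h : IsShortestOddCycle G 5 c) : C5.IsIndContained G := by
  refine ⟨⟨⟨fun i : Fin 5 => c i, h.injective⟩, fun {i j} => ?_⟩⟩
  have : ∀ i j : Fin 5, C5.Adj i j ↔ j = i + 1 ∨ i = j + 1 := by decide
  exact h.adj_iff.trans (this i j).symm

/-- No vertex has only one neighbour on a shortest odd cycle, if there is no induced path on five vertices with a further vertex that
is adjacent to its vertex `k` only. -/
theorem adj_add_two_or (h : IsShortestOddCycle G n c) (h7 : 7 ≤ n) {k : ℕ} (hk : k ≤ 4)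
    (hG : ∀ (d : ℕ → V) (x : V), (∀ a ≤ 4, ∀ b ≤ 4, d a = d b → a = b) →
      (∀ a ≤ 4, ∀ b ≤ 4, (G.Adj (d a) (d b) ↔ a = b + 1 ∨ b = a + 1)) →
      (∀ a ≤ 4, d a ≠ x) → (∀ a ≤ 4, (G.Adj x (d a) ↔ a = k)) → False)
    {x : V} {i : ZMod n} (hi : G.Adj x (c i)) : G.Adj x (c (i + 2)) ∨ G.Adj x (c (i - 2)) := by
  by_contra! hcon
  have hall : ∀ j, G.Adj x (c j) ↔ j = i := by
    refine fun j => ⟨fun hj => ?_, fun h => h ▸ hi⟩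
    by_contra hne
    rcases h.eq_add_two_or hi hj (Ne.symm hne) with rfl | rfl
    · exact hcon.1 hj
    · exact hcon.2 (by simpa using hj)
  have hcast : ∀ a : ℕ, a ≤ 5 → ∀ b : ℕ, b ≤ 5 → ((a : ZMod n) = b ↔ a = b) := by
    intro a ha b hb
    rw [ZMod.natCast_eq_natCast_iff', Nat.mod_eq_of_lt (by omega), Nat.mod_eq_of_lt (by omega)]
  have hcast' : ∀ a : ℕ, a ≤ 4 → ∀ b : ℕ, b ≤ 4 → ((a : ZMod n) = b + 1 ↔ a = b + 1) := by
    intro a ha b hb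
    rw [← hcast a (by omega) (b + 1) (by omega)]
    push_cast
    rfl
  -- The path of five consecutive cycle vertices is shifted so that `c i` is its vertex number `k`.
  refine hG (fun a => c (i - k + a)) x (fun a ha b hb hab => ?_) (fun a ha b hb => ?_)
    (fun a ha hax => ?_) fun a ha => ?_
  · exact (hcast a (by omega) b (by omega)).1 (add_left_cancel (h.injective hab))
  · rw [h.adj_iff, ← hcast' a ha b hb, ← hcast' b hb a ha, add_assoc, add_assoc, add_right_inj,
      add_right_inj, or_comm]
  · subst hax
    have h1 : G.Adj (c (i - k + a)) (c (i - k + a + 1)) := h.adj _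
    have h2 : G.Adj (c (i - k + a)) (c (i - k + a - 1)) := by
      simpa using (h.adj (i - k + a - 1)).symm
    refine h.two_ne_zero ?_
    linear_combination (hall _).1 h1 - (hall _).1 h2
  · rw [hall, ← hcast a (by omega) k (by omega)]
    constructor
    · intro h
      linear_combination h
    · intro h
      linear_combination h

theorem update (h : IsShortestOddCycle G n c) {x : V} {i : ZMod n} (h1 : G.Adj x (c (i - 1)))
    (h2 : G.Adj x (c (i + 1))) : IsShortestOddCycle G n (Function.update c i x) := by
  have h2' := h.two_ne_zero
  have h1' : (1 : ZMod n) ≠ 0 := fun h => h2' (by linear_combination 2 * h)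
  refine ⟨h.odd, h.five_le, fun j => ?_, h.le_length⟩
  by_cases hj : j = i
  · subst hj
    rw [Function.update_self, Function.update_of_ne (by simpa using h1')]
    exact h2
  · rw [Function.update_of_ne hj]
    by_cases hj' : j + 1 = i
    · subst hj'
      rw [Function.update_self]
      simpa using h1.symm
    · rw [Function.update_of_ne hj']
      exact h.adj j

/-- A homomorphism from an odd cycle of length at least five to the five-cycle. -/
theorem exists_hom_C5 (hn : Odd n) (h5 : 5 ≤ n) :
    ∃ φ : ZMod n → Fin 5, ∀ i, C5.Adj (φ i) (φ (i + 1)) := by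
  have : NeZero n := ⟨by omega⟩
  have : Fact (1 < n) := ⟨by omega⟩
  -- The colors are 0, 1, 2, 3, 4, 0, 4, 0, …; since `n - 1` is even, the last one is 4, which is
  -- adjacent to 0.
  have hstep : ∀ k < n, C5.Adj (if k < 4 then Fin.ofNat 5 k else if Odd k then 0 else 4)
      (if (k + 1) % n < 4 then Fin.ofNat 5 ((k + 1) % n) else if Odd ((k + 1) % n) then 0 else 4) := by
    intro k hk
    rcases Nat.lt_or_ge k 4 with h | h
    · rw [Nat.mod_eq_of_lt (by omega)]
      interval_cases k <;> decide
    · rw [if_neg (by omega)]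
      rcases (show k + 1 ≤ n from hk).eq_or_lt with hk | hk
      · have hke : ¬ Odd k := by
          rw [← hk] at hn
          simpa [Nat.odd_add_one] using hn
        rw [hk, Nat.mod_self, if_neg hke]
        decide
      · rw [Nat.mod_eq_of_lt hk, if_neg (show ¬ k + 1 < 4 by omega)]
        by_cases hke : Odd k <;> simp only [hke, Nat.odd_add_one, if_true, if_false, not_true_eq_false,
          not_false_eq_true] <;> decide
  refine ⟨fun i => if i.val < 4 then Fin.ofNat 5 i.val else if Odd i.val then 0 else 4, fun i => ?_⟩
  have := hstep i.val (ZMod.val_lt i)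
  rwa [show (i.val + 1) % n = (i + 1).val by rw [ZMod.val_add, ZMod.val_one]] at this

/-- Every vertex turns out to be a twin of exactly one cycle position, and adjacent vertices have
consecutive positions. This is a homomorphism to the `n`-cycle, hence to `C5`. -/
theorem lt_seven (h : IsShortestOddCycle G n c) (hmin : IsMinimalObstruction C5 G) {k : ℕ}
    (hk : k ≤ 4)
    (hG : ∀ (d : ℕ → V) (x : V), (∀ a ≤ 4, ∀ b ≤ 4, d a = d b → a = b) →
      (∀ a ≤ 4, ∀ b ≤ 4, (G.Adj (d a) (d b) ↔ a = b + 1 ∨ b = a + 1)) →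
      (∀ a ≤ 4, d a ≠ x) → (∀ a ≤ 4, (G.Adj x (d a) ↔ a = k)) → False) : n < 7 := by
  by_contra! h7
  have h2 := h.two_ne_zero
  have h4 := h.four_ne_zero
  -- On the cycle with `x` in position `i`, `y` sees `i` and, say, `i + 2`. On the original cycle it
  -- then sees `i` or `i + 4` besides `i + 2`; the latter would be a third neighbour on the modified
  -- cycle. So `y` is a twin of position `i + 1`.
  have hstep : ∀ x y i, G.Adj x (c (i - 1)) → G.Adj x (c (i + 1)) → G.Adj x y →
      ∃ j, (j = i + 1 ∨ i = j + 1) ∧ G.Adj y (c (j - 1)) ∧ G.Adj y (c (j + 1)) := by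
    intro x y i h1 h1' hxy
    have hu := h.update h1 h1'
    have hyx : G.Adj y (Function.update c i x i) := by simpa using hxy.symm
    have hne : ∀ {a : ZMod n}, a ≠ 0 → Function.update c i x (i + a) = c (i + a) := fun ha =>
      Function.update_of_ne (by simpa using ha) _ _
    have hne' : ∀ {a : ZMod n}, a ≠ 0 → Function.update c i x (i - a) = c (i - a) := fun ha =>
      Function.update_of_ne (by simpa using ha) _ _
    rcases hu.adj_add_two_or h7 hk hG hyx with hy | hy
    · refine ⟨i + 1, Or.inl rfl, ?_⟩
      have hy' := hy
      rw [hne h2] at hy'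
      rw [add_sub_cancel_right, show i + 1 + 1 = i + 2 by ring]
      refine ⟨?_, hy'⟩
      rcases h.adj_add_two_or h7 hk hG hy' with hz | hz
      · exfalso
        rw [show i + 2 + 2 = i + 4 by ring, ← hne h4] at hz
        rcases hu.eq_or_eq_add_two hyx hy hz with h0 | h0
        · exact h4 (by linear_combination h0)
        · exact h2 (by linear_combination h0)
      · simpa using hz
    · refine ⟨i - 1, Or.inr (by ring), ?_⟩
      have hy' := hy
      rw [hne' h2] at hy'
      rw [sub_add_cancel, show i - 1 - 1 = i - 2 by ring]
      refine ⟨hy', ?_⟩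
      rcases h.adj_add_two_or h7 hk hG hy' with hz | hz
      · simpa using hz
      · exfalso
        rw [show i - 2 - 2 = i - 4 by ring, ← hne' h4] at hz
        rcases hu.eq_or_eq_add_two hz (by rwa [show i - 4 + 2 = i - 2 by ring]) hyx with h0 | h0
        · exact h4 (by linear_combination h0)
        · exact h2 (by linear_combination h0)
  have huniv : {x | ∃ i, G.Adj x (c (i - 1)) ∧ G.Adj x (c (i + 1))} = Set.univ := by
    by_contra hne
    obtain ⟨x, ⟨i, h1, h1'⟩, y, hy, hxy⟩ := hmin.exists_adj
      (s := {x | ∃ i, G.Adj x (c (i - 1)) ∧ G.Adj x (c (i + 1))})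
      ⟨c 0, 0, by simpa using (h.adj (0 - 1)).symm, h.adj 0⟩ hne
    obtain ⟨j, -, hj⟩ := hstep x y i h1 h1' hxy
    exact hy ⟨j, hj⟩
  choose col hcol using fun x => (huniv ▸ Set.mem_univ x : x ∈ {x | ∃ i, G.Adj x (c (i - 1)) ∧
    G.Adj x (c (i + 1))})
  obtain ⟨φ, hφ⟩ := exists_hom_C5 h.odd h.five_le
  refine hmin.1 ⟨⟨fun x => φ (col x), fun {x y} hxy => ?_⟩⟩
  obtain ⟨j, hj, hy1, hy2⟩ := hstep x y (col x) (hcol x).1 (hcol x).2 hxy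
  have hcy : col y = j := by
    have key : ∀ a b, G.Adj y (c (a - 1)) → G.Adj y (c (a + 1)) → G.Adj y (c (b - 1)) →
        G.Adj y (c (b + 1)) → a = b := by
      intro a b h1 h1' h3 h3'
      have h1'' : G.Adj y (c (a - 1 + 2)) := by rwa [show a - 1 + 2 = a + 1 by ring]
      rcases h.eq_or_eq_add_two h1 h1'' h3 with e | e
      · linear_combination -e
      · rcases h.eq_or_eq_add_two h1 h1'' h3' with e' | e'
        · exact absurd (show (4 : ZMod n) = 0 by linear_combination e' - e) h4
        · exact absurd (show (2 : ZMod n) = 0 by linear_combination e' - e) h2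
    exact key _ _ (hcol y).1 (hcol y).2 hy1 hy2
  rcases hj with hj | hj
  · rw [hcy, hj]
    exact hφ _
  · rw [hcy, hj]
    exact (hφ _).symm

end IsShortestOddCycle

theorem isIndContained_K3 {a b d : V} (hab : G.Adj a b) (hbd : G.Adj b d) (had : G.Adj a d) :
    K3.IsIndContained G := by
  refine Realizes.isIndContained (P := [[true, true], [true], []]) (ws := [0, 1, 2]) (us := [a, b, d])
    (by decide) (by decide) (by decide) ?_
  simp [Realizes, RowFits, hab, hbd, had]

/-- A shortest closed walk of odd length, indexed cyclically; length one would be a loop and length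
three a triangle. -/
theorem exists_isShortestOddCycle (h2 : ¬ G.Colorable 2) (hK3 : InducedFree K3 G) :
    ∃ (n : ℕ) (c : ZMod n → V), IsShortestOddCycle G n c := by
  classical
  have hex : ∃ n, Odd n ∧ ∃ (v : V) (p : G.Walk v v), p.length = n := by
    rw [two_colorable_iff_forall_loop_even] at h2
    push Not at h2
    obtain ⟨v, p, hp⟩ := h2
    exact ⟨_, Nat.not_even_iff_odd.1 hp, v, p, rfl⟩
  obtain ⟨hodd, v, p, hp⟩ := Nat.find_spec hex
  have hmin : ∀ (w : V) (q : G.Walk w w), Odd q.length → Nat.find hex ≤ q.length :=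
    fun w q hq => Nat.find_min' hex ⟨hq, w, q, rfl⟩
  generalize Nat.find hex = n at hodd hp hmin
  have hn0 : n ≠ 0 := by
    rintro rfl
    exact absurd hodd (by decide)
  have : NeZero n := ⟨hn0⟩
  have hn1 : n ≠ 1 := by
    rintro rfl
    have := p.adj_getVert_succ (i := 0) (by omega)
    rw [zero_add, ← hp, Walk.getVert_length, Walk.getVert_zero] at this
    exact G.loopless.irrefl _ this
  have : Fact (1 < n) := ⟨by omega⟩
  have hadj : ∀ i : ZMod n, G.Adj (p.getVert i.val) (p.getVert (i + 1).val) := by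
    intro i
    have hi := ZMod.val_lt i
    have h1 := p.adj_getVert_succ (i := i.val) (by omega)
    have hv : (i + 1).val = (i.val + 1) % n := by rw [ZMod.val_add, ZMod.val_one]
    rcases (show i.val + 1 ≤ n from hi).eq_or_lt with h | h
    · rw [h, Nat.mod_self] at hv
      rw [hv, Walk.getVert_zero]
      rwa [h, p.getVert_of_length_le hp.le] at h1
    · rw [Nat.mod_eq_of_lt h] at hv
      rwa [hv]
  refine ⟨n, fun i => p.getVert i.val, hodd, ?_, hadj, hmin⟩
  by_contra! hlt
  have hn3 : n = 3 := by
    obtain ⟨k, hk⟩ := hodd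
    omega
  subst hn3
  exact hK3 (isIndContained_K3 (hadj 0) (hadj 1) (hadj 2).symm)

theorem IsMinimalObstruction.isIndContained_C5 (hmin : IsMinimalObstruction C5 G)
    (hK3 : InducedFree K3 G) {k : ℕ} (hk : k ≤ 4)
    (hG : ∀ (d : ℕ → V) (x : V), (∀ a ≤ 4, ∀ b ≤ 4, d a = d b → a = b) →
      (∀ a ≤ 4, ∀ b ≤ 4, (G.Adj (d a) (d b) ↔ a = b + 1 ∨ b = a + 1)) →
      (∀ a ≤ 4, d a ≠ x) → (∀ a ≤ 4, (G.Adj x (d a) ↔ a = k)) → False) : C5.IsIndContained G := by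
  have h2 : ¬ G.Colorable 2 := by
    rintro ⟨φ⟩
    refine hmin.1 ⟨⟨fun v => if φ v = 0 then 0 else 1, fun {u v} huv => ?_⟩⟩
    have hne := φ.valid huv
    have key : ∀ a b : Fin 2, a ≠ b → C5.Adj (if a = 0 then 0 else 1) (if b = 0 then 0 else 1) := by
      decide
    exact key _ _ hne
  obtain ⟨n, c, h⟩ := exists_isShortestOddCycle h2 hK3
  have h7 := h.lt_seven hmin hk hG
  have h5 := h.five_le
  have hodd := h.odd
  obtain rfl : n = 5 := by
    interval_cases n
    · rfl
    · exact absurd hodd (by decide)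
  exact h.isIndContained_C5

end OddCycle

/-! ### Patterns and masks of the concrete graphs -/

section Data

/-- The graph `S_{2,2,1}`, with each of its vertices in turn as the first, up to symmetry; the empty first row is omitted. -/
def claw221Patterns : List (List (List Bool)) := [
  [[true], [false, true], [false, true, false], [false, true, false, false], [false, false, false, false, true]],
  [[true], [true, false], [false, false, true], [false, true, false, false], [false, false, false, true, false]],
  [[true], [true, false], [true, false, false], [true, false, false, false], [false, false, true, false, false]],
  [[true], [true, false], [false, true, false], [false, true, false, false], [false, true, false, false, false]]]

/-- The graph `S_{3,1,1}`, in the same form. -/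
def claw311Patterns : List (List (List Bool)) := [
  [[true], [true, false], [true, false, false], [false, false, false, true], [false, false, false, false, true]],
  [[true], [false, true], [true, false, false], [false, false, true, false], [false, false, false, true, false]],
  [[true], [true, false], [false, false, true], [false, true, false, false], [false, false, true, false, false]],
  [[true], [true, false], [true, false, false], [true, false, false, false], [false, true, false, false, false]],
  [[true], [true, false], [true, false, false], [true, false, false, false], [false, false, false, true, false]]]

/-- The five-cycle with a twin of one of its vertices, in the same form. -/
def twinPatterns : List (List (List Bool)) := [
  [[true], [true, false], [true, false, true], [false, true, false, false], [true, false, false, false, true]],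
  [[true], [false, true], [true, true, false], [false, true, false, false], [true, false, false, true, false]],
  [[true], [true, false], [true, false, false], [true, false, false, true], [false, true, false, true, false]]]

/-- The five-cycle with a pendant vertex, in the same form. -/
def pendantPatterns : List (List (List Bool)) := [
  [[true], [true, false], [true, false, false], [true, false, false, true], [false, false, false, false, true]],
  [[true], [false, true], [true, false, false], [true, false, true, false], [false, false, false, true, false]],
  [[true], [true, false], [false, false, true], [true, true, false, false], [false, false, true, false, false]],
  [[true], [true, false], [true, false, false], [true, false, false, false], [true, false, false, true, false]]]

/-- The adjacency masks of `octagon4`. -/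
def octagon4Rows : List (ℕ × ℕ) :=
  [(0, 146), (1, 37), (2, 74), (3, 148), (4, 41), (5, 82), (6, 164), (7, 73)]

/-- The rows of the lower triangular adjacency matrix of `octagon4`. -/
def octagon4Pattern : List (List Bool) := [
  [],
  [true],
  [true, false],
  [true, false, false],
  [true, false, false, true],
  [true, false, false, true, false],
  [true, false, false, true, false, false],
  [true, false, false, true, false, false, true]]

/-- The adjacency masks of `octagon3`. -/
def octagon3Rows : List (ℕ × ℕ) :=
  [(0, 146), (1, 37), (2, 10), (3, 148), (4, 41), (5, 82), (6, 160), (7, 73)]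

/-- The rows of the lower triangular adjacency matrix of `octagon3`. -/
def octagon3Pattern : List (List Bool) := [
  [],
  [true],
  [true, false],
  [true, false, false],
  [true, false, false, true],
  [true, false, false, true, false],
  [true, false, false, false, false, false],
  [true, false, false, true, false, false, true]]

/-- The adjacency masks of `octagon2Adjacent`. -/
def octagon2AdjacentRows : List (ℕ × ℕ) :=
  [(0, 146), (1, 5), (2, 10), (3, 148), (4, 41), (5, 80), (6, 160), (7, 73)]

/-- The rows of the lower triangular adjacency matrix of `octagon2Adjacent`. -/
def octagon2AdjacentPattern : List (List Bool) := [
  [],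
  [true],
  [true, false],
  [true, false, false],
  [true, false, false, true],
  [true, false, false, false, false],
  [true, false, false, false, false, false],
  [true, false, false, true, false, false, true]]

/-- The adjacency masks of `octagon2Perpendicular`. -/
def octagon2PerpendicularRows : List (ℕ × ℕ) :=
  [(0, 130), (1, 37), (2, 10), (3, 148), (4, 40), (5, 82), (6, 160), (7, 73)]

/-- The rows of the lower triangular adjacency matrix of `octagon2Perpendicular`. -/
def octagon2PerpendicularPattern : List (List Bool) := [
  [],
  [true],
  [true, false],
  [true, false, false],
  [true, false, false, false],
  [true, false, false, true, false],
  [true, false, false, false, false, false],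
  [true, false, false, true, false, false, true]]

/-- The adjacency masks of `circulantFin13`. -/
def circulantFin13Rows : List (ℕ × ℕ) :=
  [(0, 4626), (1, 1061), (2, 2122), (3, 4244), (4, 297), (5, 594), (6, 1188), (7, 2376), (8, 4752), (9, 1313), (10, 2626),
  (11, 5252), (12, 2313)]

/-- The rows of the lower triangular adjacency matrix of `circulantFin13`. -/
def circulantFin13Pattern : List (List Bool) := [
  [],
  [true],
  [true, false],
  [true, false, false],
  [true, false, false, true],
  [true, false, false, true, false],
  [true, false, false, true, false, false],
  [true, false, false, true, false, false, false],
  [true, false, false, true, false, false, false, false],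
  [true, false, false, true, false, false, false, false, true],
  [true, false, false, true, false, false, false, false, true, false],
  [true, false, false, true, false, false, false, false, true, false, false],
  [true, false, false, true, false, false, false, false, true, false, false, true]]

/-- The adjacency masks of the five-cycle with a twin of one of its vertices. -/
def twinRows : List (ℕ × ℕ) := [(0, 50), (1, 5), (2, 42), (3, 20), (4, 9), (5, 5)]

/-- The adjacency masks of the five-cycle with a pendant vertex. -/
def pendantRows : List (ℕ × ℕ) := [(0, 50), (1, 5), (2, 10), (3, 20), (4, 9), (5, 1)]

/-- The adjacency masks of the triangle. -/
def K3Rows : List (ℕ × ℕ) := [(0, 6), (1, 5), (2, 3)]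

/-- The five-cycle on `0, …, 4` with a twin `5` of the vertex `1`. -/
def twin : SimpleGraph (Fin 6) :=
  SimpleGraph.fromEdgeSet {s(0, 1), s(1, 2), s(2, 3), s(3, 4), s(4, 0), s(5, 0), s(5, 2)}

/-- The five-cycle on `0, …, 4` with a pendant vertex `5` at the vertex `0`. -/
def pendant : SimpleGraph (Fin 6) :=
  SimpleGraph.fromEdgeSet {s(0, 1), s(1, 2), s(2, 3), s(3, 4), s(4, 0), s(5, 0)}

instance : DecidableRel twin.Adj := by unfold twin; infer_instance
instance : DecidableRel pendant.Adj := by unfold pendant; infer_instance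
instance : DecidableRel octagon4.Adj := by unfold octagon4; infer_instance
instance : DecidableRel octagon3.Adj := by unfold octagon3; infer_instance
instance : DecidableRel octagon2Adjacent.Adj := by unfold octagon2Adjacent; infer_instance
instance : DecidableRel octagon2Perpendicular.Adj := by unfold octagon2Perpendicular; infer_instance

/-- The graph `circulant13`, with the residues as elements of `Fin 13`. -/
def circulantFin13 : SimpleGraph (Fin 13) := circulant13

instance : DecidableRel circulantFin13.Adj := by
  have : DecidableRel circulant13.Adj := by unfold circulant13; infer_instance
  exact this

instance (a b c : ℕ) : DecidableRel (subdividedClaw a b c).Adj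
  | none, none => isFalse (SimpleGraph.irrefl _)
  | none, some q => decidable_of_iff (q.2.val = 0) (by simp [subdividedClaw])
  | some q, none => decidable_of_iff (q.2.val = 0) (by simp [subdividedClaw])
  | some p, some q => decidable_of_iff (p ≠ q ∧ ((p.1 = q.1 ∧ q.2.val = p.2.val + 1) ∨
      (q.1 = p.1 ∧ p.2.val = q.2.val + 1))) (by simp [subdividedClaw])

/-- The vertices of `S_{2,2,1}`: the centre and then the legs. -/
def claw221Vertex : Fin 6 → Option (Σ i : Fin 3, Fin (![2, 2, 1] i)) :=
  ![none, some ⟨0, ⟨0, by decide⟩⟩, some ⟨0, ⟨1, by decide⟩⟩, some ⟨1, ⟨0, by decide⟩⟩,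
    some ⟨1, ⟨1, by decide⟩⟩, some ⟨2, ⟨0, by decide⟩⟩]

/-- The vertices of `S_{3,1,1}`: the centre and then the legs. -/
def claw311Vertex : Fin 6 → Option (Σ i : Fin 3, Fin (![3, 1, 1] i)) :=
  ![none, some ⟨0, ⟨0, by decide⟩⟩, some ⟨0, ⟨1, by decide⟩⟩, some ⟨0, ⟨2, by decide⟩⟩,
    some ⟨1, ⟨0, by decide⟩⟩, some ⟨2, ⟨0, by decide⟩⟩]

/-- Each pattern of the list describes the graph `F`, with the vertices in the corresponding order. -/
def DescribePatterns {W : Type*} (F : SimpleGraph W) (l : List (List (List Bool)))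
    (ws : List (List W)) : Prop :=
  List.Forall₂ (fun p w => Triangular (p.reverseAux [[]]) ∧ Realizes F (p.reverseAux [[]]) w ∧
    ∀ v, v ∈ w) l ws

theorem DescribePatterns.not_realizes {V W : Type*} {F : SimpleGraph W} {G : SimpleGraph V}
    {l : List (List (List Bool))} {ws : List (List W)} (h : DescribePatterns F l ws)
    (hF : InducedFree F G) : ∀ p ∈ l, ∀ us, ¬ Realizes G (p.reverseAux [[]]) us := by
  induction h with
  | nil => simp
  | cons h _ ih => exact List.forall_mem_cons.2 ⟨hF.not_realizes h.1 h.2.1 h.2.2, ih⟩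

theorem describe_claw221Patterns : DescribePatterns (subdividedClaw 2 2 1) claw221Patterns
    ([[5, 4, 2, 3, 1, 0], [5, 4, 2, 3, 0, 1], [5, 4, 3, 0, 1, 2], [4, 2, 3, 1, 0, 5]].map (List.map claw221Vertex)) := by
  repeat' refine List.Forall₂.cons ⟨by decide, by decide, by decide⟩ ?_
  exact List.Forall₂.nil

theorem describe_claw311Patterns : DescribePatterns (subdividedClaw 3 1 1) claw311Patterns
    ([[5, 4, 3, 2, 1, 0], [5, 4, 3, 2, 0, 1], [5, 4, 3, 0, 1, 2], [5, 4, 0, 1, 2, 3], [5, 3, 2, 1, 0, 4]].map (List.map claw311Vertex)) := by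
  repeat' refine List.Forall₂.cons ⟨by decide, by decide, by decide⟩ ?_
  exact List.Forall₂.nil

theorem describe_twinPatterns : DescribePatterns twin twinPatterns
    [[4, 3, 5, 2, 1, 0], [4, 3, 5, 2, 0, 1], [5, 4, 0, 1, 2, 3]] := by
  repeat' refine List.Forall₂.cons ⟨by decide, by decide, by decide⟩ ?_
  exact List.Forall₂.nil

theorem describe_pendantPatterns : DescribePatterns pendant pendantPatterns
    [[5, 4, 3, 2, 1, 0], [5, 4, 3, 2, 0, 1], [5, 4, 3, 0, 1, 2], [4, 3, 2, 1, 0, 5]] := by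
  repeat' refine List.Forall₂.cons ⟨by decide, by decide, by decide⟩ ?_
  exact List.Forall₂.nil

theorem describe_K3 : DescribePatterns K3 [[[true], [true, true]]] [[2, 1, 0]] :=
  List.Forall₂.cons ⟨by decide, by decide, by decide⟩ List.Forall₂.nil

theorem realizes_octagon4 : Realizes octagon4 (octagon4Pattern.reverseAux []) (List.finRange 8).reverse := by
  decide

theorem describes_octagon4 : Describes octagon4 (Fin.ofNat 8) octagon4Rows octagon4Rows :=
  ⟨by decide, by decide⟩

theorem realizes_octagon3 : Realizes octagon3 (octagon3Pattern.reverseAux []) (List.finRange 8).reverse := by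
  decide

theorem describes_octagon3 : Describes octagon3 (Fin.ofNat 8) octagon3Rows octagon3Rows :=
  ⟨by decide, by decide⟩

theorem realizes_octagon2Adjacent : Realizes octagon2Adjacent (octagon2AdjacentPattern.reverseAux []) (List.finRange 8).reverse := by
  decide

theorem describes_octagon2Adjacent : Describes octagon2Adjacent (Fin.ofNat 8) octagon2AdjacentRows octagon2AdjacentRows :=
  ⟨by decide, by decide⟩

theorem realizes_octagon2Perpendicular : Realizes octagon2Perpendicular (octagon2PerpendicularPattern.reverseAux []) (List.finRange 8).reverse := by
  decide

theorem describes_octagon2Perpendicular : Describes octagon2Perpendicular (Fin.ofNat 8) octagon2PerpendicularRows octagon2PerpendicularRows :=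
  ⟨by decide, by decide⟩

theorem realizes_circulantFin13 : Realizes circulantFin13 (circulantFin13Pattern.reverseAux []) (List.finRange 13).reverse := by
  decide

theorem describes_circulantFin13 : Describes circulantFin13 (Fin.ofNat 13) circulantFin13Rows circulantFin13Rows :=
  ⟨by decide, by decide⟩

theorem describes_K3 : Describes K3 (Fin.ofNat 3) K3Rows K3Rows := ⟨by decide, by decide⟩

theorem describes_twin : Describes twin (Fin.ofNat 6) twinRows twinRows := ⟨by decide, by decide⟩

theorem describes_pendant : Describes pendant (Fin.ofNat 6) pendantRows pendantRows :=
  ⟨by decide, by decide⟩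

theorem describes_C5 : Describes C5 (Fin.ofNat 5) cycleRows cycleRows := ⟨by decide, by decide⟩

end Data

/-! ### Running the search from an induced five-cycle -/

section Start

variable {V W : Type*} {G : SimpleGraph V}

theorem State.of_embedding {n : ℕ} [NeZero n] {O : SimpleGraph (Fin n)} {S : List (ℕ × ℕ)} (e : O ↪g G)
    (hd : Describes O (Fin.ofNat n) S S) (hlt : ∀ x ∈ S, x.1 < n ∧ x.2 < 2 ^ n) :
    State G (fun i => e (Fin.ofNat n i)) S n :=
  ⟨⟨fun x hx y hy => e.map_adj_iff.trans (hd.adj x hx y hy),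
    fun x hx y hy h => hd.inj x hx y hy (e.injective h)⟩, hlt⟩

theorem State.covers_range {f : ℕ → V} {S : List (ℕ × ℕ)} {n : ℕ} (h : State G f S n) :
    Covers G f S n (List.range (2 ^ n)) := by
  classical
  refine ⟨fun M hM => List.mem_range.1 hM, fun w hw => ?_⟩
  refine ⟨Nat.ofBits fun i : Fin n => decide (G.Adj (f i) w),
    List.mem_range.2 (Nat.ofBits_lt_two_pow _), hw, fun x hx => ?_⟩
  rw [Nat.testBit_ofBits_lt _ _ (h.lt x hx).1]
  simp

/-- The search `check`, started from the graph `S` on `n` vertices. -/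
def startCheck (forb obs : List (List (List Bool))) (S : List (ℕ × ℕ)) (n : ℕ) : Bool :=
  check forb obs 15 S n (List.range (2 ^ n))

/-- The fuel 15 bounds the number of nested calls; running out of it only makes the check fail. -/
theorem inducedFree_of_startCheck (hG : IsMinimalObstruction C5 G)
    {forb obs : List (List (List Bool))}
    (hforb : ∀ p ∈ forb, ∀ us, ¬ Realizes G (p.reverseAux [[]]) us)
    (hobs : ∀ p ∈ obs, ∀ us, ¬ Realizes G (p.reverseAux []) us) {n : ℕ} [NeZero n]
    {O : SimpleGraph (Fin n)} {S : List (ℕ × ℕ)} (hd : Describes O (Fin.ofNat n) S S) (hS : S ≠ [])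
    (hlt : ∀ x ∈ S, x.1 < n ∧ x.2 < 2 ^ n) (h : startCheck forb obs S n = true) :
    InducedFree O G := by
  rintro ⟨e⟩
  have hst := State.of_embedding e hd hlt
  exact check_eq_true_imp_false hG hforb hobs 15 S n _ _ hS hst hst.covers_range h

/-- Three stages, each of which may forbid what the earlier ones excluded: a five-cycle with a twin,
then one with a pendant vertex, then the bare five-cycle. The added patterns keep the later searches
small. -/
theorem inducedFree_C5_of_startCheck (hG : IsMinimalObstruction C5 G)
    {forb obs : List (List (List Bool))}
    (hforb : ∀ p ∈ forb, ∀ us, ¬ Realizes G (p.reverseAux [[]]) us)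
    (hobs : ∀ p ∈ obs, ∀ us, ¬ Realizes G (p.reverseAux []) us)
    (h1 : startCheck forb obs twinRows 6 = true)
    (h2 : startCheck (forb ++ twinPatterns) obs pendantRows 6 = true)
    (h3 : startCheck (forb ++ twinPatterns ++ pendantPatterns) obs cycleRows 5 = true) :
    InducedFree C5 G := by
  have htwin := inducedFree_of_startCheck hG hforb hobs describes_twin (by decide) (by decide) h1
  have hforb2 := List.forall_mem_append.2 ⟨hforb, describe_twinPatterns.not_realizes htwin⟩
  have hpendant := inducedFree_of_startCheck hG hforb2 hobs describes_pendant (by decide) (by decide) h2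
  have hforb3 := List.forall_mem_append.2 ⟨hforb2, describe_pendantPatterns.not_realizes hpendant⟩
  exact inducedFree_of_startCheck hG hforb3 hobs describes_C5 (by decide) (by decide) h3

theorem startCheck_claw221_twin : startCheck ([[true], [true, true]] :: claw221Patterns)
    [octagon4Pattern, circulantFin13Pattern] twinRows 6 = true := by
  decide +kernel

theorem startCheck_claw221_pendant :
    startCheck ([[true], [true, true]] :: claw221Patterns ++ twinPatterns)
      [octagon4Pattern, circulantFin13Pattern] pendantRows 6 = true := by
  decide +kernel

/-- The search ends at once: a nonempty trace on the five-cycle contains an edge (a triangle), is a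
single vertex (pendant) or is a non-adjacent pair (twin), and all of these are forbidden. -/
theorem startCheck_claw221_cycle :
    startCheck ([[true], [true, true]] :: claw221Patterns ++ twinPatterns ++ pendantPatterns)
      [octagon4Pattern, circulantFin13Pattern] cycleRows 5 = true := by
  decide +kernel

theorem startCheck_claw311_twin : startCheck ([[true], [true, true]] :: claw311Patterns)
    [octagon4Pattern, octagon2AdjacentPattern, octagon3Pattern, octagon2PerpendicularPattern]
    twinRows 6 = true := by
  decide +kernel

theorem startCheck_claw311_pendant :
    startCheck ([[true], [true, true]] :: claw311Patterns ++ twinPatterns)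
      [octagon4Pattern, octagon2AdjacentPattern, octagon3Pattern, octagon2PerpendicularPattern]
      pendantRows 6 = true := by
  decide +kernel

theorem startCheck_claw311_cycle :
    startCheck ([[true], [true, true]] :: claw311Patterns ++ twinPatterns ++ pendantPatterns)
      [octagon4Pattern, octagon2AdjacentPattern, octagon3Pattern, octagon2PerpendicularPattern]
      cycleRows 5 = true := by
  decide +kernel

end Start

/-! ### Verifying the listed obstructions -/

section Concrete

variable {V W : Type*} {G : SimpleGraph V} {f : ℕ → V} {S : List (ℕ × ℕ)}

/-- Deleting single vertices is enough, since every proper vertex set misses one and colorings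
restrict. -/
theorem Describes.isMinimalObstruction (hd : Describes G f S S) (hf : ∀ v, ∃ x ∈ S, f x.1 = v)
    (h1 : colorSearch S [] = false)
    (h2 : ∀ x ∈ S, colorSearch (S.filter fun y => !Nat.beq y.1 x.1) [] = true) :
    IsMinimalObstruction C5 G := by
  refine ⟨fun ⟨φ⟩ => ?_, fun s hs => ?_⟩
  · have := colorSearch_of_hom hd φ S [] (List.Subset.refl _) (by simp)
    rw [List.map_nil, h1] at this
    exact absurd this (by simp)
  · obtain ⟨v, hv⟩ := (Set.ne_univ_iff_exists_notMem s).1 hs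
    obtain ⟨x, hx, rfl⟩ := hf v
    refine nonempty_hom_induce (fun u hu => ?_) (nonempty_hom_of_colorSearch (f := f)
      ⟨fun y hy z hz => hd.adj y (List.mem_of_mem_filter hy) z (List.mem_of_mem_filter hz),
        fun y hy z hz => hd.inj y (List.mem_of_mem_filter hy) z (List.mem_of_mem_filter hz)⟩ (h2 x hx))
    obtain ⟨y, hy, rfl⟩ := hf u
    refine ⟨y, List.mem_filter.2 ⟨hy, ?_⟩, rfl⟩
    rw [Bool.not_eq_true', Bool.eq_false_iff]
    intro hxy
    exact hv (Nat.eq_of_beq_eq_true hxy ▸ hu)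

theorem Describes.inducedFree (hd : Describes G f S S) (hf : ∀ v, ∃ x ∈ S, f x.1 = v) {full : ℕ}
    (hfull : ∀ x ∈ S, full.testBit x.1 = true) {F : SimpleGraph W} {p : List (List Bool)} {ws : List W}
    (hF : Realizes F (p.reverseAux []) ws) (hs : search full S p [] = false) : InducedFree F G := by
  rintro ⟨e⟩
  have h := search_of_realizes hd hf hfull p [] [] (ws.map e).reverse (by simp)
    (by simpa using hF.length_eq) (by simpa using hF.map e)
  rw [hs] at h
  exact absurd h (by simp)

theorem isMinimalObstruction_K3 : IsMinimalObstruction C5 K3 :=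
  describes_K3.isMinimalObstruction (by decide) (by decide) (by decide)

theorem isMinimalObstruction_octagon4 : IsMinimalObstruction C5 octagon4 :=
  describes_octagon4.isMinimalObstruction (by decide) (by decide +kernel) (by decide +kernel)

theorem isMinimalObstruction_octagon3 : IsMinimalObstruction C5 octagon3 :=
  describes_octagon3.isMinimalObstruction (by decide) (by decide +kernel) (by decide +kernel)

theorem isMinimalObstruction_octagon2Adjacent : IsMinimalObstruction C5 octagon2Adjacent :=
  describes_octagon2Adjacent.isMinimalObstruction (by decide) (by decide +kernel) (by decide +kernel)

theorem isMinimalObstruction_octagon2Perpendicular : IsMinimalObstruction C5 octagon2Perpendicular :=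
  describes_octagon2Perpendicular.isMinimalObstruction (by decide) (by decide +kernel)
    (by decide +kernel)

theorem isMinimalObstruction_circulantFin13 : IsMinimalObstruction C5 circulantFin13 :=
  describes_circulantFin13.isMinimalObstruction (by decide) (by decide +kernel) (by decide +kernel)

theorem realizes_claw221 :
    Realizes (subdividedClaw 2 2 1) (([] :: claw221Patterns.head (by decide)).reverseAux [])
      ([5, 4, 2, 3, 1, 0].map claw221Vertex) := by
  decide

theorem realizes_claw311 :
    Realizes (subdividedClaw 3 1 1) (([] :: claw311Patterns.head (by decide)).reverseAux [])
      ([5, 4, 3, 2, 1, 0].map claw311Vertex) := by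
  decide

theorem realizes_K3 : Realizes K3 ([[], [true], [true, true]].reverseAux []) [2, 1, 0] := by
  decide

theorem inducedFree_octagon4 {F : SimpleGraph W} {p : List (List Bool)} {ws : List W}
    (hF : Realizes F (p.reverseAux []) ws) (hs : search 255 octagon4Rows p [] = false) :
    InducedFree F octagon4 :=
  describes_octagon4.inducedFree (by decide) (by decide) hF hs

theorem inducedFree_octagon3 {F : SimpleGraph W} {p : List (List Bool)} {ws : List W}
    (hF : Realizes F (p.reverseAux []) ws) (hs : search 255 octagon3Rows p [] = false) :
    InducedFree F octagon3 :=
  describes_octagon3.inducedFree (by decide) (by decide) hF hs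

theorem inducedFree_octagon2Adjacent {F : SimpleGraph W} {p : List (List Bool)} {ws : List W}
    (hF : Realizes F (p.reverseAux []) ws) (hs : search 255 octagon2AdjacentRows p [] = false) :
    InducedFree F octagon2Adjacent :=
  describes_octagon2Adjacent.inducedFree (by decide) (by decide) hF hs

theorem inducedFree_octagon2Perpendicular {F : SimpleGraph W} {p : List (List Bool)} {ws : List W}
    (hF : Realizes F (p.reverseAux []) ws) (hs : search 255 octagon2PerpendicularRows p [] = false) :
    InducedFree F octagon2Perpendicular :=
  describes_octagon2Perpendicular.inducedFree (by decide) (by decide) hF hs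

theorem inducedFree_circulantFin13 {F : SimpleGraph W} {p : List (List Bool)} {ws : List W}
    (hF : Realizes F (p.reverseAux []) ws) (hs : search 8191 circulantFin13Rows p [] = false) :
    InducedFree F circulantFin13 :=
  describes_circulantFin13.inducedFree (by decide) (by decide) hF hs

theorem inducedFree_K3 {F : SimpleGraph W} {p : List (List Bool)} {ws : List W}
    (hF : Realizes F (p.reverseAux []) ws) (hs : search 7 K3Rows p [] = false) : InducedFree F K3 :=
  describes_K3.inducedFree (by decide) (by decide) hF hs

end Concrete

/-! ### Classification and counting -/

section Claws

variable {V : Type*} {G : SimpleGraph V}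

theorem InducedFree.claw221_path (h : InducedFree (subdividedClaw 2 2 1) G) (d : ℕ → V) (x : V)
    (hd : ∀ a ≤ 4, ∀ b ≤ 4, d a = d b → a = b)
    (hadj : ∀ a ≤ 4, ∀ b ≤ 4, (G.Adj (d a) (d b) ↔ a = b + 1 ∨ b = a + 1)) (hx : ∀ a ≤ 4, d a ≠ x)
    (hxadj : ∀ a ≤ 4, (G.Adj x (d a) ↔ a = 2)) : False := by
  -- The centre is `d 2`, with legs `d 3, d 4` and `d 1, d 0` and the single vertex `x`.
  refine h.not_realizes (P := ([] :: claw221Patterns.head (by decide)).reverseAux []) (by decide)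
    realizes_claw221 (by decide) [x, d 0, d 4, d 1, d 3, d 2] ?_
  have hne : ∀ a ≤ 4, ∀ b ≤ 4, a ≠ b → d a ≠ d b := fun a ha b hb hab h => hab (hd a ha b hb h)
  have hne' : ∀ a ≤ 4, x ≠ d a := fun a ha => (hx a ha).symm
  simp [claw221Patterns, Realizes, RowFits, hadj, hxadj, hne, hne']

theorem InducedFree.claw311_path (h : InducedFree (subdividedClaw 3 1 1) G) (d : ℕ → V) (x : V)
    (hd : ∀ a ≤ 4, ∀ b ≤ 4, d a = d b → a = b)
    (hadj : ∀ a ≤ 4, ∀ b ≤ 4, (G.Adj (d a) (d b) ↔ a = b + 1 ∨ b = a + 1)) (hx : ∀ a ≤ 4, d a ≠ x)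
    (hxadj : ∀ a ≤ 4, (G.Adj x (d a) ↔ a = 1)) : False := by
  -- The centre is `d 1`, with the long leg `d 2, d 3, d 4` and the single vertices `d 0` and `x`.
  refine h.not_realizes (P := ([] :: claw311Patterns.head (by decide)).reverseAux []) (by decide)
    realizes_claw311 (by decide) [x, d 0, d 4, d 3, d 2, d 1] ?_
  have hne : ∀ a ≤ 4, ∀ b ≤ 4, a ≠ b → d a ≠ d b := fun a ha b hb hab h => hab (hd a ha b hb h)
  have hne' : ∀ a ≤ 4, x ≠ d a := fun a ha => (hx a ha).symm
  simp [claw311Patterns, Realizes, RowFits, hadj, hxadj, hne, hne']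

theorem IsMinimalObstruction.isIndContained_C5_of_claw (hG : IsMinimalObstruction C5 G)
    (hF : InducedFree (subdividedClaw 2 2 1) G ∨ InducedFree (subdividedClaw 3 1 1) G)
    (hK3 : InducedFree K3 G) : C5.IsIndContained G := by
  rcases hF with hF | hF
  · exact hG.isIndContained_C5 hK3 (by norm_num) hF.claw221_path
  · exact hG.isIndContained_C5 hK3 (by norm_num) hF.claw311_path

theorem InducedFree.not_realizes_pattern {n : ℕ} {O : SimpleGraph (Fin n)} (h : InducedFree O G)
    {p : List (List Bool)} (hO : Realizes O (p.reverseAux []) (List.finRange n).reverse)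
    (hp : Triangular (p.reverseAux [])) : ∀ us, ¬ Realizes G (p.reverseAux []) us :=
  h.not_realizes hp hO (by simp)

/-- If `G` is isomorphic to none of the graphs, it contains none of them; then the search forbids
the induced `C5` that the odd-cycle argument provides. -/
theorem isMinimalObstruction_and_claw221_iff : IsMinimalObstruction C5 G ∧
    InducedFree (subdividedClaw 2 2 1) G ↔ Nonempty (G ≃g K3) ∨ Nonempty (G ≃g octagon4) ∨
      Nonempty (G ≃g circulantFin13) := by
  constructor
  · rintro ⟨hG, hF⟩
    by_contra! hcon
    obtain ⟨h1, h2, h3⟩ := hcon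
    have hK3 : InducedFree K3 G := fun h =>
      h1.false (hG.nonempty_iso isMinimalObstruction_K3.1 h).some
    have hW : InducedFree octagon4 G := fun h =>
      h2.false (hG.nonempty_iso isMinimalObstruction_octagon4.1 h).some
    have hX : InducedFree circulantFin13 G := fun h =>
      h3.false (hG.nonempty_iso isMinimalObstruction_circulantFin13.1 h).some
    refine inducedFree_C5_of_startCheck hG (List.forall_mem_cons.2
      ⟨(List.forall_mem_singleton.1 (describe_K3.not_realizes hK3)),
        describe_claw221Patterns.not_realizes hF⟩) ?_ startCheck_claw221_twin
      startCheck_claw221_pendant startCheck_claw221_cycle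
      (hG.isIndContained_C5_of_claw (Or.inl hF) hK3)
    simp only [List.forall_mem_cons]
    exact ⟨hW.not_realizes_pattern realizes_octagon4 (by decide),
      hX.not_realizes_pattern realizes_circulantFin13 (by decide), by simp⟩
  · rintro (⟨⟨e⟩⟩ | ⟨⟨e⟩⟩ | ⟨⟨e⟩⟩)
    · exact ⟨isMinimalObstruction_K3.of_iso e,
        (inducedFree_K3 realizes_claw221 (by decide +kernel)).of_iso e⟩
    · exact ⟨isMinimalObstruction_octagon4.of_iso e,
        (inducedFree_octagon4 realizes_claw221 (by decide +kernel)).of_iso e⟩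
    · exact ⟨isMinimalObstruction_circulantFin13.of_iso e,
        (inducedFree_circulantFin13 realizes_claw221 (by decide +kernel)).of_iso e⟩

theorem isMinimalObstruction_and_claw311_iff : IsMinimalObstruction C5 G ∧
    InducedFree (subdividedClaw 3 1 1) G ↔ Nonempty (G ≃g K3) ∨ Nonempty (G ≃g octagon4) ∨
      Nonempty (G ≃g octagon2Adjacent) ∨ Nonempty (G ≃g octagon3) ∨
      Nonempty (G ≃g octagon2Perpendicular) := by
  constructor
  · rintro ⟨hG, hF⟩
    by_contra! hcon
    obtain ⟨h1, h2, h3, h4, h5⟩ := hcon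
    have hK3 : InducedFree K3 G := fun h =>
      h1.false (hG.nonempty_iso isMinimalObstruction_K3.1 h).some
    have hO4 : InducedFree octagon4 G := fun h =>
      h2.false (hG.nonempty_iso isMinimalObstruction_octagon4.1 h).some
    have hO2 : InducedFree octagon2Adjacent G := fun h =>
      h3.false (hG.nonempty_iso isMinimalObstruction_octagon2Adjacent.1 h).some
    have hO3 : InducedFree octagon3 G := fun h =>
      h4.false (hG.nonempty_iso isMinimalObstruction_octagon3.1 h).some
    have hO2' : InducedFree octagon2Perpendicular G := fun h =>
      h5.false (hG.nonempty_iso isMinimalObstruction_octagon2Perpendicular.1 h).some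
    refine inducedFree_C5_of_startCheck hG (List.forall_mem_cons.2
      ⟨(List.forall_mem_singleton.1 (describe_K3.not_realizes hK3)),
        describe_claw311Patterns.not_realizes hF⟩) ?_ startCheck_claw311_twin
      startCheck_claw311_pendant startCheck_claw311_cycle
      (hG.isIndContained_C5_of_claw (Or.inr hF) hK3)
    simp only [List.forall_mem_cons]
    exact ⟨hO4.not_realizes_pattern realizes_octagon4 (by decide),
      hO2.not_realizes_pattern realizes_octagon2Adjacent (by decide),
      hO3.not_realizes_pattern realizes_octagon3 (by decide),
      hO2'.not_realizes_pattern realizes_octagon2Perpendicular (by decide), by simp⟩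
  · rintro (⟨⟨e⟩⟩ | ⟨⟨e⟩⟩ | ⟨⟨e⟩⟩ | ⟨⟨e⟩⟩ | ⟨⟨e⟩⟩)
    · exact ⟨isMinimalObstruction_K3.of_iso e,
        (inducedFree_K3 realizes_claw311 (by decide +kernel)).of_iso e⟩
    · exact ⟨isMinimalObstruction_octagon4.of_iso e,
        (inducedFree_octagon4 realizes_claw311 (by decide +kernel)).of_iso e⟩
    · exact ⟨isMinimalObstruction_octagon2Adjacent.of_iso e,
        (inducedFree_octagon2Adjacent realizes_claw311 (by decide +kernel)).of_iso e⟩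
    · exact ⟨isMinimalObstruction_octagon3.of_iso e,
        (inducedFree_octagon3 realizes_claw311 (by decide +kernel)).of_iso e⟩
    · exact ⟨isMinimalObstruction_octagon2Perpendicular.of_iso e,
        (inducedFree_octagon2Perpendicular realizes_claw311 (by decide +kernel)).of_iso e⟩

/-- A non-colorable graph contains a minimal obstruction as an induced subgraph, which inherits all
three exclusions but must contain a five-cycle. -/
theorem nonempty_hom_C5_of_claw [Finite V]
    (hF : InducedFree (subdividedClaw 2 2 1) G ∨ InducedFree (subdividedClaw 3 1 1) G)
    (hC5 : InducedFree C5 G) (hK3 : InducedFree K3 G) : Nonempty (G →g C5) := by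
  by_contra hcon
  obtain ⟨s, hs⟩ := exists_isMinimalObstruction_induce hcon
  exact hC5.induce s (hs.isIndContained_C5_of_claw
    (hF.imp (fun h => h.induce s) fun h => h.induce s) (hK3.induce s))

/-- The pairwise hypothesis serves only to separate the classes: isomorphic graphs contain each
other. -/
theorem encard_obstructionClasses {U W : Type*} {H : SimpleGraph W} {F : SimpleGraph U}
    (l : List (Σ n : ℕ, SimpleGraph (Fin n)))
    (h : ∀ (n : ℕ) (G : SimpleGraph (Fin n)),
      IsMinimalObstruction H G ∧ InducedFree F G ↔ ∃ O ∈ l, Nonempty (G ≃g O.2))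
    (hl : l.Pairwise fun A B => InducedFree A.2 B.2) :
    (obstructionClasses H F).encard = l.length := by
  classical
  let mk : (Σ n : ℕ, SimpleGraph (Fin n)) → FiniteGraphClass := Quotient.mk graphIsoSetoid
  have hnodup : (l.map mk).Nodup := by
    refine List.pairwise_map.2 (hl.imp fun {A B} hAB heq => hAB ?_)
    obtain ⟨e⟩ : Nonempty (A.2 ≃g B.2) := Quotient.exact heq
    exact ⟨e.toEmbedding⟩
  have hset : obstructionClasses H F = ((l.map mk).toFinset : Set FiniteGraphClass) := by
    ext q
    simp only [List.coe_toFinset, List.mem_map]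
    constructor
    · rintro ⟨n, G, rfl, hG⟩
      obtain ⟨O, hO, ⟨e⟩⟩ := (h n G).1 hG
      exact ⟨O, hO, Quotient.sound ⟨e.symm⟩⟩
    · rintro ⟨O, hO, rfl⟩
      exact ⟨O.1, O.2, rfl, (h O.1 O.2).2 ⟨O, hO, ⟨Iso.refl⟩⟩⟩
  rw [hset, Set.encard_coe_eq_coe_finsetCard, List.toFinset_card_of_nodup hnodup, List.length_map]

theorem encard_obstructionClasses_claw221 :
    (obstructionClasses C5 (subdividedClaw 2 2 1)).encard = 3 := by
  refine encard_obstructionClasses [⟨3, K3⟩, ⟨8, octagon4⟩, ⟨13, circulantFin13⟩]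
    (fun n G => by simpa using isMinimalObstruction_and_claw221_iff) ?_
  simp only [List.pairwise_cons, List.forall_mem_cons]
  exact ⟨⟨inducedFree_octagon4 realizes_K3 (by decide +kernel),
    inducedFree_circulantFin13 realizes_K3 (by decide +kernel), by simp⟩,
    ⟨inducedFree_circulantFin13 realizes_octagon4 (by decide +kernel), by simp⟩, by simp⟩

theorem encard_obstructionClasses_claw311 :
    (obstructionClasses C5 (subdividedClaw 3 1 1)).encard = 5 := by
  refine encard_obstructionClasses [⟨3, K3⟩, ⟨8, octagon4⟩, ⟨8, octagon2Adjacent⟩, ⟨8, octagon3⟩,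
    ⟨8, octagon2Perpendicular⟩] (fun n G => by simpa using isMinimalObstruction_and_claw311_iff) ?_
  simp only [List.pairwise_cons, List.forall_mem_cons]
  exact ⟨⟨inducedFree_octagon4 realizes_K3 (by decide +kernel),
      inducedFree_octagon2Adjacent realizes_K3 (by decide +kernel),
      inducedFree_octagon3 realizes_K3 (by decide +kernel),
      inducedFree_octagon2Perpendicular realizes_K3 (by decide +kernel), by simp⟩,
    ⟨inducedFree_octagon2Adjacent realizes_octagon4 (by decide +kernel),
      inducedFree_octagon3 realizes_octagon4 (by decide +kernel),
      inducedFree_octagon2Perpendicular realizes_octagon4 (by decide +kernel), by simp⟩,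
    ⟨inducedFree_octagon3 realizes_octagon2Adjacent (by decide +kernel),
      inducedFree_octagon2Perpendicular realizes_octagon2Adjacent (by decide +kernel), by simp⟩,
    ⟨inducedFree_octagon2Perpendicular realizes_octagon3 (by decide +kernel), by simp⟩, by simp⟩

end Claws

end HColoring

theorem theorem2 :
    -- up to isomorphism there are exactly three, respectively exactly five, obstructions
    (HColoring.obstructionClasses HColoring.C5 (HColoring.subdividedClaw 2 2 1)).encard = 3 ∧
    (HColoring.obstructionClasses HColoring.C5 (HColoring.subdividedClaw 3 1 1)).encard = 5 ∧
    -- the explicit list for `S_{2,2,1}`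
    (∀ (V : Type u) [Finite V] (G : SimpleGraph V),
      (HColoring.IsMinimalObstruction HColoring.C5 G ∧
          HColoring.InducedFree (HColoring.subdividedClaw 2 2 1) G) ↔
        (Nonempty (G ≃g HColoring.K3) ∨ Nonempty (G ≃g HColoring.octagon4) ∨
          Nonempty (G ≃g HColoring.circulant13))) ∧
    -- the explicit list for `S_{3,1,1}`
    (∀ (V : Type u) [Finite V] (G : SimpleGraph V),
      (HColoring.IsMinimalObstruction HColoring.C5 G ∧
          HColoring.InducedFree (HColoring.subdividedClaw 3 1 1) G) ↔
        (Nonempty (G ≃g HColoring.K3) ∨ Nonempty (G ≃g HColoring.octagon4) ∨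
          Nonempty (G ≃g HColoring.octagon2Adjacent) ∨ Nonempty (G ≃g HColoring.octagon3) ∨
          Nonempty (G ≃g HColoring.octagon2Perpendicular))) ∧
    -- graphs that are `{F, C_5, K_3}`-free are `C_5`-colorable
    (∀ (V : Type u) [Finite V] (G : SimpleGraph V),
      (HColoring.InducedFree (HColoring.subdividedClaw 2 2 1) G ∨
          HColoring.InducedFree (HColoring.subdividedClaw 3 1 1) G) →
        HColoring.InducedFree HColoring.C5 G → HColoring.InducedFree HColoring.K3 G →
          Nonempty (G →g HColoring.C5)) := by
  exact ⟨HColoring.encard_obstructionClasses_claw221, HColoring.encard_obstructionClasses_claw311,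
    fun _ _ _ => HColoring.isMinimalObstruction_and_claw221_iff,
    fun _ _ _ => HColoring.isMinimalObstruction_and_claw311_iff,
    fun _ _ _ hF hC5 hK3 => HColoring.nonempty_hom_C5_of_claw hF hC5 hK3⟩
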